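/- A set $F$ of vertices of a simplicial complex $\Delta$ is a \emph{missing $i$-face} of $\Delta$ if $|F|=i+1$, $F$ is not a face of $\Delta$, and every proper subset of $F$ is a face of $\Delta$; let $m_i(\Delta)$ denote the number of missing $i$-faces of $\Delta$. A \emph{PL $4$-sphere} is a finite simplicial complex whose geometric realization is piecewise linearly homeomorphic to the boundary of the $5$-dimensional simplex. It is \emph{$2$-neighborly} if every two of its vertices form an edge, that is, if $f_1=\binom{f_0}{2}$, where $f_i$ denotes the number of $i$-dimensional faces. \textbf{Theorem.} For every integer $n\ge 9$ and every integer $m$ with $0\le m\le \binom{n-5}{2}$ and $m\ne \binom{n-5}{2}-1$, there exists a $2$-neighborly PL $4$-sphere $\Delta$ with exactly $n$ vertices and $m_3(\Delta)=m$. -/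

import Mathlib

/-- A convex polyhedron: an intersection of finitely many closed half-spaces. -/
def IsConvexPolyhedron {E : Type*} [AddCommGroup E] [Module ℝ E] (P : Set E) : Prop :=
  ∃ H : Finset (E →ᵃ[ℝ] ℝ), P = {x | ∀ h ∈ H, 0 ≤ h x}

/-- A map `f : s → t` is piecewise linear if `s` is a union of finitely many convex polyhedra,
on each of which `f` is the restriction of an affine map. (When `s` is bounded, as it is for the
geometric realization of a finite simplicial complex, these polyhedra are polytopes.) -/
def IsPiecewiseLinear {E F : Type*} [AddCommGroup E] [Module ℝ E] [AddCommGroup F] [Module ℝ F]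
    {s : Set E} {t : Set F} (f : s → t) : Prop :=
  ∃ 𝒞 : Set (Set E), 𝒞.Finite ∧ ⋃₀ 𝒞 = s ∧
    ∀ P ∈ 𝒞, IsConvexPolyhedron P ∧ ∃ A : E →ᵃ[ℝ] F, ∀ x : s, (x : E) ∈ P → (f x : F) = A x

/-- Piecewise linear homeomorphism of two sets. -/
def PLHomeomorphic {E F : Type*} [AddCommGroup E] [Module ℝ E] [TopologicalSpace E]
    [AddCommGroup F] [Module ℝ F] [TopologicalSpace F] (s : Set E) (t : Set F) : Prop :=
  ∃ e : s ≃ₜ t, IsPiecewiseLinear e ∧ IsPiecewiseLinear e.symm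

namespace AbstractSimplicialComplex

/-- Mathlib lists only the nonempty faces of a complex; here the empty set counts as a face. -/
def IsFace {V : Type*} (Δ : AbstractSimplicialComplex V) (F : Finset V) : Prop :=
  F = ∅ ∨ F ∈ Δ.faces

/-- A missing face: not a face, although all its proper subsets are faces. -/
def IsMissingFace {V : Type*} (Δ : AbstractSimplicialComplex V) (F : Finset V) : Prop :=
  ¬ Δ.IsFace F ∧ ∀ G : Finset V, G ⊂ F → Δ.IsFace G

/-- The number `f_{k-1}` of faces of size `k`, that is, of dimension `k - 1`. -/
noncomputable def faceCount {V : Type*} (Δ : AbstractSimplicialComplex V) (k : ℕ) : ℕ :=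
  Set.ncard {F : Finset V | Δ.IsFace F ∧ F.card = k}

/-- The number `m_i` of missing `i`-faces, that is, of missing faces of size `i + 1`. -/
noncomputable def missingFaceCount {V : Type*} (Δ : AbstractSimplicialComplex V) (i : ℕ) : ℕ :=
  Set.ncard {F : Finset V | Δ.IsMissingFace F ∧ F.card = i + 1}

/-- `Δ` is `k`-neighborly if `f_{k-1} = (f_0 choose k)`. -/
def IsNeighborly {V : Type*} (Δ : AbstractSimplicialComplex V) (k : ℕ) : Prop :=
  Δ.faceCount k = (Δ.faceCount 1).choose k

/-- The geometric realization of a complex on a finite vertex set `V`, in `V → ℝ`: the points of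
the standard simplex (barycentric coordinates) whose support is a face. -/
def realization {V : Type*} [Fintype V] (Δ : AbstractSimplicialComplex V) : Set (V → ℝ) :=
  {x | x ∈ stdSimplex ℝ V ∧ ∃ F ∈ Δ.faces, ∀ v : V, v ∈ F ↔ x v ≠ 0}

/-- The boundary complex of the `(d + 1)`-dimensional simplex: all nonempty proper subsets of a
set of `d + 2` vertices. -/
def simplexBoundary (d : ℕ) : AbstractSimplicialComplex (Fin (d + 2)) where
  faces := {F | F.Nonempty ∧ F ≠ Finset.univ}
  isRelLowerSet_faces := by
    intro F hF
    refine ⟨hF.1, fun G hGF hG => ⟨hG, ?_⟩⟩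
    rintro rfl
    exact hF.2 (Finset.univ_subset_iff.mp hGF)
  singleton_mem := by
    intro v
    refine ⟨Finset.singleton_nonempty v, fun h => ?_⟩
    have hc := congrArg Finset.card h
    simp at hc

/-- A PL `d`-sphere: the geometric realization is piecewise linearly homeomorphic to the boundary
of a `(d + 1)`-dimensional simplex. -/
def IsPLSphere {V : Type*} [Fintype V] (Δ : AbstractSimplicialComplex V) (d : ℕ) : Prop :=
  PLHomeomorphic Δ.realization (simplexBoundary d).realization

end AbstractSimplicialComplex

/-! The spheres grow by a sewing operation. In the join of two integer paths the tetrahedra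
`gridCell i j` correspond to the unit squares of a grid. Let K be a 2-neighborly 4-sphere containing
a cone w * R, where R is a region of such tetrahedra that contains every vertex except w. Replace w
* R by the cone from a new vertex w' over its boundary R ∪ w * ∂R. All old vertices lie on that
boundary, and the deleted faces have at least three vertices, so the result is again 2-neighborly.
If w lies in no missing tetrahedron and R has no missing triangle, the new missing tetrahedra are
exactly the sets w ∪ T, where T is an interior triangle of R without interior edges
(`IsConeIn.missingTetra_reconed`). A shelling of R splits the replacement into bistellar flips
(`IsConeIn.isFlippable_reconed`), and a flip preserves the PL type by an explicit formula
(`IsFlippable.plHomeomorphic`). The link of w' contains R and all tetrahedra w * T with T a boundary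
triangle of R. If w is named as the next vertex of one of the paths, some of these are new grid
cells, R grows, and the operation can be repeated with apex w' (`IsConeSphere.reconed`).

It remains to count. The regions are staircases: full columns of height t, then one column of height
s on the right. A single column contributes t - 1 missing tetrahedra, a full column next to one of
height s ≥ 2 contributes t - s, and from two full columns on the contribution is zero, so vertices
can be added for free.

Starting from the boundary of a 5-simplex, single columns of heights 2, 3, ... give binom(n-5, 2).
For smaller m > 0, stop this process at k + 7 vertices, with binom(k+2, 2) the largest such value
not exceeding m. The remainder d ≤ k + 1 comes from one step with s = k + 2 - d. If d = k + 1, this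
would force s = 1, which is not allowed; the remainder is then split over two steps, at the price of
one more vertex. That vertex is missing only for n = k + 8, which is the excluded value m =
binom(n-5, 2) - 1. For m = 0 the process starts from an explicit sphere with nine vertices that
contains a cone over two full columns. -/

section PiecewiseLinear

/-! ### Polyhedra and composition of piecewise linear maps. -/

variable {E F G : Type*} [AddCommGroup E] [Module ℝ E] [AddCommGroup F] [Module ℝ F]
  [AddCommGroup G] [Module ℝ G]

theorem IsConvexPolyhedron.inter {P Q : Set E} (hP : IsConvexPolyhedron P)
    (hQ : IsConvexPolyhedron Q) : IsConvexPolyhedron (P ∩ Q) := by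
  classical
  obtain ⟨H, rfl⟩ := hP
  obtain ⟨H', rfl⟩ := hQ
  refine ⟨H ∪ H', ?_⟩
  ext x
  simp only [Set.mem_inter_iff, Set.mem_ofPred_eq, Finset.mem_union]
  constructor
  · rintro ⟨h1, h2⟩ h (hh | hh)
    exacts [h1 h hh, h2 h hh]
  · exact fun h => ⟨fun k hk => h k (Or.inl hk), fun k hk => h k (Or.inr hk)⟩

theorem IsConvexPolyhedron.preimage {Q : Set F} (hQ : IsConvexPolyhedron Q) (A : E →ᵃ[ℝ] F) :
    IsConvexPolyhedron (A ⁻¹' Q) := by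
  classical
  obtain ⟨H, rfl⟩ := hQ
  refine ⟨H.image fun h => h.comp A, ?_⟩
  ext x
  simp

theorem isConvexPolyhedron_setOf_forall {ι : Type*} [Finite ι] (h : ι → E →ₗ[ℝ] ℝ) :
    IsConvexPolyhedron {x | ∀ i, 0 ≤ h i x} := by
  classical
  have := Fintype.ofFinite ι
  refine ⟨Finset.univ.image fun i => (h i).toAffineMap, ?_⟩
  ext x
  simp

theorem isConvexPolyhedron_setOf_eq (h : E →ₗ[ℝ] ℝ) (c : ℝ) :
    IsConvexPolyhedron {x | h x = c} := by
  classical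
  refine ⟨{h.toAffineMap - AffineMap.const ℝ E c, AffineMap.const ℝ E c - h.toAffineMap}, ?_⟩
  ext x
  simp only [Set.mem_ofPred_eq, Finset.mem_insert, Finset.mem_singleton, forall_eq_or_imp,
    forall_eq, AffineMap.coe_sub, Pi.sub_apply, LinearMap.coe_toAffineMap, AffineMap.const_apply]
  constructor
  · intro h; constructor <;> linarith
  · rintro ⟨h1, h2⟩; linarith

/-- The pieces of the composite are P ∩ A⁻¹(Q), where A is the affine map that represents the inner
function on P. -/
theorem IsPiecewiseLinear.comp {s : Set E} {t : Set F} {u : Set G} {g : t → u} {f : s → t}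
    (hg : IsPiecewiseLinear g) (hf : IsPiecewiseLinear f) : IsPiecewiseLinear (g ∘ f) := by
  obtain ⟨C, hC, hCs, hCf⟩ := hf
  obtain ⟨C', hC', hCs', hCg⟩ := hg
  choose! hp A hA using hCf
  choose! hp' A' hA' using hCg
  refine ⟨(fun q : Set E × Set F => q.1 ∩ A q.1 ⁻¹' q.2) '' (C ×ˢ C'),
    (hC.prod hC').image _, ?_, ?_⟩
  · ext x
    simp only [Set.sUnion_image, Set.mem_iUnion, Set.mem_prod, Prod.exists, Set.mem_inter_iff,
      Set.mem_preimage, exists_prop]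
    constructor
    · rintro ⟨P, Q, ⟨hP, -⟩, hx, -⟩
      rw [← hCs]
      exact ⟨P, hP, hx⟩
    · intro hx
      obtain ⟨P, hP, hxP⟩ : x ∈ ⋃₀ C := by rwa [hCs]
      have h1 := hA P hP ⟨x, hx⟩ hxP
      obtain ⟨Q, hQ, hxQ⟩ : (f ⟨x, hx⟩ : F) ∈ ⋃₀ C' := by
        rw [hCs']; exact (f ⟨x, hx⟩).2
      exact ⟨P, Q, ⟨hP, hQ⟩, hxP, h1 ▸ hxQ⟩
  · rintro _ ⟨⟨P, Q⟩, ⟨hP, hQ⟩, rfl⟩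
    refine ⟨(hp P hP).inter ((hp' Q hQ).preimage _), (A' Q).comp (A P), ?_⟩
    rintro x ⟨hxP, hxQ⟩
    have h1 := hA P hP x hxP
    have h2 := hA' Q hQ (f x) (by rw [h1]; exact hxQ)
    simp [h2, h1]

theorem PLHomeomorphic.trans [TopologicalSpace E] [TopologicalSpace F] [TopologicalSpace G]
    {s : Set E} {t : Set F} {u : Set G} (h : PLHomeomorphic s t) (h' : PLHomeomorphic t u) :
    PLHomeomorphic s u := by
  obtain ⟨e, he, he'⟩ := h
  obtain ⟨e', h1, h2⟩ := h'
  exact ⟨e.trans e', h1.comp he, he'.comp h2⟩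

end PiecewiseLinear

/-! ### Geometric realizations and relabelling of vertices. -/

section Realization

variable {W U : Type*} [Fintype W] [Fintype U]

/-- The points of the standard simplex whose support belongs to the family `K`. -/
def geomReal (K : Set (Finset W)) : Set (W → ℝ) :=
  {x | x ∈ stdSimplex ℝ W ∧ ∃ F ∈ K, ∀ v : W, v ∈ F ↔ x v ≠ 0}

/-- The closed face of the standard simplex spanned by `F`. -/
def closedFace (F : Finset W) : Set (W → ℝ) :=
  {x | x ∈ stdSimplex ℝ W ∧ ∀ v, v ∉ F → x v = 0}

theorem isConvexPolyhedron_closedFace (F : Finset W) : IsConvexPolyhedron (closedFace F) := by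
  classical
  have h1 := isConvexPolyhedron_setOf_forall
    (fun v : W => (LinearMap.proj v : (W → ℝ) →ₗ[ℝ] ℝ))
  have h2 := isConvexPolyhedron_setOf_forall
    (fun v : {v : W // v ∉ F} => (-LinearMap.proj v.1 : (W → ℝ) →ₗ[ℝ] ℝ))
  have h3 := isConvexPolyhedron_setOf_eq
    (∑ v : W, LinearMap.proj v : (W → ℝ) →ₗ[ℝ] ℝ) 1
  suffices h : closedFace F = _ from h ▸ (h1.inter h2).inter h3
  ext x
  simp only [closedFace, stdSimplex, Set.mem_ofPred_eq, Set.mem_inter_iff, LinearMap.proj_apply,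
    LinearMap.neg_apply, LinearMap.sum_apply, Subtype.forall]
  constructor
  · rintro ⟨⟨ha, hb⟩, hc⟩
    exact ⟨⟨ha, fun v hv => by rw [hc v hv]; simp⟩, hb⟩
  · rintro ⟨⟨ha, hc⟩, hb⟩
    exact ⟨⟨ha, hb⟩, fun v hv => le_antisymm (by linarith [hc v hv]) (ha v)⟩

theorem closedFace_subset_geomReal {K : Set (Finset W)} (hK : IsLowerSet K) {F : Finset W}
    (hF : F ∈ K) : closedFace F ⊆ geomReal K := by
  classical
  rintro x ⟨hx, h0⟩
  refine ⟨hx, Finset.univ.filter fun v => x v ≠ 0, hK ?_ hF, by simp⟩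
  intro v hv
  by_contra hn
  simp [h0 v hn] at hv

theorem mem_closedFace_of_support {x : W → ℝ} (hx : x ∈ stdSimplex ℝ W) {F : Finset W}
    (h : ∀ v : W, v ∈ F ↔ x v ≠ 0) : x ∈ closedFace F :=
  ⟨hx, fun v hv => by by_contra hn; exact hv ((h v).2 hn)⟩

theorem sUnion_closedFace {K : Set (Finset W)} (hK : IsLowerSet K) :
    ⋃₀ (closedFace '' K) = geomReal K := by
  ext x
  simp only [Set.sUnion_image, Set.mem_iUnion, exists_prop]
  constructor
  · rintro ⟨F, hF, hx⟩
    exact closedFace_subset_geomReal hK hF hx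
  · rintro ⟨hx, F, hF, hs⟩
    exact ⟨F, hF, mem_closedFace_of_support hx hs⟩

theorem geomReal_eq_of_nonempty {K : Set (Finset W)} :
    geomReal {F | F.Nonempty ∧ F ∈ K} = geomReal K := by
  ext x
  simp only [geomReal, Set.mem_ofPred_eq]
  refine and_congr_right fun hx => exists_congr fun F => ?_
  constructor
  · rintro ⟨⟨-, h⟩, h'⟩
    exact ⟨h, h'⟩
  · rintro ⟨h, h'⟩
    refine ⟨⟨?_, h⟩, h'⟩
    rw [Finset.nonempty_iff_ne_empty]
    rintro rfl
    have : ∀ v, x v = 0 := fun v => by simpa using h' v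
    have h1 := hx.2
    simp [this] at h1

/-- Relabelling the vertices is a piecewise linear homeomorphism. -/
theorem geomReal_plHomeomorphic_of_embedding (e : U ↪ W) {K : Set (Finset U)}
    (hK : IsLowerSet K) {K' : Set (Finset W)} (hK' : IsLowerSet K')
    (hm : ∀ F, F ∈ K' ↔ ∃ G ∈ K, G.map e = F) :
    PLHomeomorphic (geomReal K') (geomReal K) := by
  classical
  let f : (W → ℝ) →ₗ[ℝ] (U → ℝ) := LinearMap.funLeft ℝ ℝ e
  let g : (U → ℝ) →ₗ[ℝ] (W → ℝ) :=
    LinearMap.pi fun w => if h : ∃ u, e u = w then LinearMap.proj h.choose else 0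
  have hf : ∀ x u, f x u = x (e u) := fun x u => rfl
  have hg : ∀ y u, g y (e u) = y u := by
    intro y u
    have h : ∃ u', e u' = e u := ⟨u, rfl⟩
    have h2 : h.choose = u := e.injective h.choose_spec
    simp only [g, LinearMap.pi_apply, dif_pos h, LinearMap.proj_apply, h2]
  have hg' : ∀ y w, (¬ ∃ u, e u = w) → g y w = 0 := by
    intro y w h
    simp only [g, LinearMap.pi_apply, dif_neg h, LinearMap.zero_apply]
  have hsum : ∀ x : W → ℝ, (∀ w, (¬ ∃ u, e u = w) → x w = 0) → ∑ w, x w = ∑ u, x (e u) := by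
    intro x hx
    rw [← Finset.sum_map Finset.univ e x]
    symm
    apply Finset.sum_subset (Finset.subset_univ _)
    intro w _ hw
    exact hx w (by simpa using hw)
  have hz : ∀ x ∈ geomReal K', ∀ w, (¬ ∃ u, e u = w) → x w = 0 := by
    rintro x ⟨hx, F, hF, hs⟩ w hw
    obtain ⟨G, hG, rfl⟩ := (hm F).1 hF
    by_contra hn
    obtain ⟨u, -, hu⟩ := Finset.mem_map.1 ((hs w).2 hn)
    exact hw ⟨u, hu⟩
  have hfm : ∀ x ∈ geomReal K', f x ∈ geomReal K := by
    intro x hx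
    have hz' := hz x hx
    obtain ⟨hx, F, hF, hs⟩ := hx
    obtain ⟨G, hG, rfl⟩ := (hm F).1 hF
    refine ⟨⟨fun u => hx.1 _, ?_⟩, G, hG, fun u => ?_⟩
    · rw [← hx.2, hsum x hz']; rfl
    · rw [hf, ← hs, Finset.mem_map' e]
  have hgm : ∀ y ∈ geomReal K, g y ∈ geomReal K' := by
    rintro y ⟨hy, G, hG, hs⟩
    refine ⟨⟨fun w => ?_, ?_⟩, G.map e, (hm _).2 ⟨G, hG, rfl⟩, fun w => ?_⟩
    · by_cases h : ∃ u, e u = w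
      · obtain ⟨u, rfl⟩ := h
        rw [hg]; exact hy.1 u
      · rw [hg' y w h]
    · rw [hsum _ (hg' y), ← hy.2]
      exact Finset.sum_congr rfl fun u _ => hg y u
    · by_cases h : ∃ u, e u = w
      · obtain ⟨u, rfl⟩ := h
        rw [hg, Finset.mem_map' e, hs]
      · rw [hg' y w h]
        simp only [Finset.mem_map, ne_eq, not_true_eq_false, iff_false]
        rintro ⟨u, -, hu⟩
        exact h ⟨u, hu⟩
  let φ : geomReal K' ≃ₜ geomReal K :=
    { toFun := fun x => ⟨f x, hfm x x.2⟩
      invFun := fun y => ⟨g y, hgm y y.2⟩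
      left_inv := by
        rintro ⟨x, hx⟩
        ext w
        by_cases h : ∃ u, e u = w
        · obtain ⟨u, rfl⟩ := h
          exact hg _ u
        · exact (hg' _ w h).trans (hz x hx w h).symm
      right_inv := by
        rintro ⟨y, hy⟩
        ext u
        exact hg y u
      continuous_toFun := by
        refine Continuous.subtype_mk ?_ _
        exact f.continuous_of_finiteDimensional.comp continuous_subtype_val
      continuous_invFun := by
        refine Continuous.subtype_mk ?_ _
        exact g.continuous_of_finiteDimensional.comp continuous_subtype_val }
  refine ⟨φ, ⟨closedFace '' K', Set.toFinite _, sUnion_closedFace hK', ?_⟩,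
    ⟨closedFace '' K, Set.toFinite _, sUnion_closedFace hK, ?_⟩⟩
  · rintro _ ⟨F, -, rfl⟩
    exact ⟨isConvexPolyhedron_closedFace F, f.toAffineMap, fun x _ => rfl⟩
  · rintro _ ⟨F, -, rfl⟩
    exact ⟨isConvexPolyhedron_closedFace F, g.toAffineMap, fun x _ => rfl⟩

end Realization

/-! ### Bistellar flips as operations on families of finite sets. -/

section Flip

variable {V : Type*} [DecidableEq V]

/-- The family obtained from `K` by the bistellar flip replacing `σ * ∂τ` by `∂σ * τ`. -/
def bistellarFlip (K : Set (Finset V)) (σ τ : Finset V) : Set (Finset V) :=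
  {F | (F ∈ K ∧ ¬ σ ⊆ F) ∨ (τ ⊆ F ∧ F ⊆ σ ∪ τ ∧ ¬ σ ⊆ F)}

/-- The conditions under which the bistellar flip replacing `σ * ∂τ` by `∂σ * τ` is allowed. -/
structure IsFlippable (K : Set (Finset V)) (σ τ : Finset V) : Prop where
  lower : IsLowerSet K
  disj : Disjoint σ τ
  left_nonempty : σ.Nonempty
  right_nonempty : τ.Nonempty
  star : ∀ F ∈ K, σ ⊆ F → F ⊆ σ ∪ τ
  mem : ∀ F, F ⊆ σ ∪ τ → ¬ τ ⊆ F → F ∈ K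
  notMem : τ ∉ K

theorem IsFlippable.isLowerSet_flip {K : Set (Finset V)} {σ τ : Finset V}
    (h : IsFlippable K σ τ) : IsLowerSet (bistellarFlip K σ τ) := by
  rintro F G hGF hF
  have hGF : G ⊆ F := hGF
  rcases hF with ⟨h1, h2⟩ | ⟨h1, h2, h3⟩
  · exact Or.inl ⟨h.lower hGF h1, fun hs => h2 (hs.trans hGF)⟩
  · by_cases hG : τ ⊆ G
    · exact Or.inr ⟨hG, hGF.trans h2, fun hs => h3 (hs.trans hGF)⟩
    · exact Or.inl ⟨h.mem G (hGF.trans h2) hG, fun hs => h3 (hs.trans hGF)⟩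

theorem IsFlippable.symm {K : Set (Finset V)} {σ τ : Finset V} (h : IsFlippable K σ τ) :
    IsFlippable (bistellarFlip K σ τ) τ σ where
  lower := h.isLowerSet_flip
  disj := h.disj.symm
  left_nonempty := h.right_nonempty
  right_nonempty := h.left_nonempty
  star := by
    rintro F (⟨h1, -⟩ | ⟨-, h2, -⟩) hF
    · exact absurd (h.lower hF h1) h.notMem
    · rwa [Finset.union_comm]
  mem := by
    intro F hF hs
    rw [Finset.union_comm] at hF
    by_cases hG : τ ⊆ F
    · exact Or.inr ⟨hG, hF, hs⟩
    · exact Or.inl ⟨h.mem F hF hG, hs⟩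
  notMem := by
    rintro (⟨-, h⟩ | ⟨-, -, h⟩) <;> exact h subset_rfl

theorem IsFlippable.flip_flip {K : Set (Finset V)} {σ τ : Finset V} (h : IsFlippable K σ τ) :
    bistellarFlip (bistellarFlip K σ τ) τ σ = K := by
  ext F
  constructor
  · rintro (⟨⟨h1, -⟩ | ⟨h1, -, -⟩, h2⟩ | ⟨-, h2, h3⟩)
    · exact h1
    · exact absurd h1 h2
    · exact h.mem F (by rwa [Finset.union_comm]) h3
  · intro hF
    have hτ : ¬ τ ⊆ F := fun ht => h.notMem (h.lower ht hF)
    by_cases hs : σ ⊆ F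
    · exact Or.inr ⟨hs, by rw [Finset.union_comm]; exact h.star F hF hs, hτ⟩
    · exact Or.inl ⟨Or.inl ⟨hF, hs⟩, hτ⟩

end Flip

/-! ### Bistellar flips preserve the piecewise linear type. -/

section FlipReal

theorem inf'_eq_zero_of_not_subset {W : Type*} {x : W → ℝ} (hx : ∀ v, 0 ≤ x v) {F σ : Finset W}
    (hσ : σ.Nonempty) (hF : ∀ v, v ∈ F ↔ x v ≠ 0) (h : ¬ σ ⊆ F) : σ.inf' hσ x = 0 := by
  obtain ⟨v, hv, hvF⟩ := Finset.not_subset.1 h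
  have h0 : x v = 0 := by by_contra hn; exact hvF ((hF v).2 hn)
  exact le_antisymm (h0 ▸ Finset.inf'_le x hv) (Finset.le_inf' hσ x fun w _ => hx w)

variable {W : Type*} [DecidableEq W]

/-- The map of realizations induced by a bistellar flip. -/
noncomputable def flipMap {σ : Finset W} (hσ : σ.Nonempty) (τ : Finset W) (x : W → ℝ) : W → ℝ :=
  fun v => if v ∈ σ then x v - σ.inf' hσ x
    else if v ∈ τ then x v + (σ.card / τ.card : ℝ) * σ.inf' hσ x else x v

theorem continuous_flipMap {σ : Finset W} (hσ : σ.Nonempty) (τ : Finset W) :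
    Continuous (flipMap hσ τ) := by
  have hinf : Continuous fun x : W → ℝ => σ.inf' hσ x :=
    Continuous.finset_inf'_apply hσ fun v _ => continuous_apply v
  refine continuous_pi fun v => ?_
  unfold flipMap
  split_ifs
  · exact (continuous_apply v).sub hinf
  · exact (continuous_apply v).add (continuous_const.mul hinf)
  · exact continuous_apply v

variable [Fintype W]

/-- The map moves mass from σ to τ in the direction of their barycenters until some σ-coordinate
vanishes. Since the mass |σ|μ is spread evenly over τ, the total stays 1. Points whose support does
not contain σ have μ = 0 and stay fixed. -/
theorem IsFlippable.flipMap_mem {K : Set (Finset W)} {σ τ : Finset W} (h : IsFlippable K σ τ)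
    {x : W → ℝ} (hx : x ∈ geomReal K) :
    flipMap h.left_nonempty τ x ∈ geomReal (bistellarFlip K σ τ) := by
  obtain ⟨hx, F, hF, hs⟩ := hx
  have hσ := h.left_nonempty
  by_cases hsF : σ ⊆ F
  · set μ := σ.inf' hσ x with hμ
    have hμpos : 0 < μ := by
      rw [hμ, Finset.lt_inf'_iff]
      intro v hv
      exact lt_of_le_of_ne (hx.1 v) (Ne.symm ((hs v).1 (hsF hv)))
    have hcs : (0 : ℝ) < σ.card := by exact_mod_cast hσ.card_pos
    have hct : (0 : ℝ) < τ.card := by exact_mod_cast h.right_nonempty.card_pos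
    have hc : 0 < (σ.card / τ.card : ℝ) * μ := by positivity
    have hd : ∀ v ∈ τ, v ∉ σ := fun v h1 h2 => Finset.disjoint_left.1 h.disj h2 h1
    have hval : ∀ v, flipMap hσ τ x v =
        x v + ((if v ∈ σ then -μ else 0) + if v ∈ τ then (σ.card / τ.card : ℝ) * μ else 0) := by
      intro v
      unfold flipMap
      by_cases h1 : v ∈ σ
      · have h2 : v ∉ τ := fun h2 => hd v h2 h1
        simp only [h1, h2, if_true, if_false]; ring
      · by_cases h2 : v ∈ τ
        · simp only [h1, h2, if_true, if_false]; ring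
        · simp only [h1, h2, if_false]; ring
    refine ⟨⟨fun v => ?_, ?_⟩, Finset.univ.filter fun v => flipMap hσ τ x v ≠ 0, ?_, by simp⟩
    · unfold flipMap
      split_ifs with h1 h2
      · linarith [Finset.inf'_le x h1]
      · linarith [hx.1 v]
      · exact hx.1 v
    · rw [Finset.sum_congr rfl fun v _ => hval v, Finset.sum_add_distrib,
        Finset.sum_add_distrib, hx.2, ← Finset.sum_filter, ← Finset.sum_filter]
      simp only [Finset.filter_univ_mem, Finset.sum_const, nsmul_eq_mul]
      field_simp
      ring
    · refine Or.inr ⟨fun v hv => ?_, fun v hv => ?_, fun hall => ?_⟩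
      · simp only [Finset.mem_filter, Finset.mem_univ, true_and]
        have : flipMap hσ τ x v = x v + (σ.card / τ.card : ℝ) * μ := by
          simp [flipMap, hd v hv, hv, hμ]
        rw [this]
        linarith [hx.1 v]
      · simp only [Finset.mem_filter, Finset.mem_univ, true_and] at hv
        by_contra hn
        rw [Finset.mem_union, not_or] at hn
        have h1 : flipMap hσ τ x v = x v := by simp [flipMap, hn.1, hn.2]
        rw [h1, ← hs] at hv
        exact (not_or.2 hn) (Finset.mem_union.1 (h.star F hF hsF hv))
      · obtain ⟨v, hv, hvμ⟩ := Finset.exists_mem_eq_inf' hσ x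
        refine (Finset.mem_filter.1 (hall hv)).2 ?_
        simp only [flipMap, if_pos hv, hvμ, sub_self]
  · have h0 := inf'_eq_zero_of_not_subset hx.1 hσ hs hsF
    have : flipMap hσ τ x = x := by
      ext v
      simp [flipMap, h0]
    rw [this]
    exact ⟨hx, F, Or.inl ⟨hF, hsF⟩, hs⟩

/-- As τ is not a face of K, some τ-coordinate of the original point is zero. After the flip the
minimum over τ is therefore exactly the amount added, and the reverse flip moves it back. -/
theorem IsFlippable.flipMap_flipMap {K : Set (Finset W)} {σ τ : Finset W}
    (h : IsFlippable K σ τ) {x : W → ℝ} (hx : x ∈ geomReal K) :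
    flipMap h.right_nonempty σ (flipMap h.left_nonempty τ x) = x := by
  obtain ⟨hx, F, hF, hs⟩ := hx
  have hσ := h.left_nonempty
  have hτ := h.right_nonempty
  set μ := σ.inf' hσ x with hμ
  have hcs : (σ.card : ℝ) ≠ 0 := by exact_mod_cast hσ.card_pos.ne'
  have hct : (τ.card : ℝ) ≠ 0 := by exact_mod_cast hτ.card_pos.ne'
  have hd : ∀ v ∈ τ, v ∉ σ := fun v h1 h2 => Finset.disjoint_left.1 h.disj h2 h1
  have h0 := inf'_eq_zero_of_not_subset hx.1 hτ hs fun ht => h.notMem (h.lower ht hF)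
  have hv : ∀ v ∈ τ, flipMap hσ τ x v = x v + (σ.card / τ.card : ℝ) * μ := by
    intro v hv
    simp [flipMap, hd v hv, hv, hμ]
  have hinf : τ.inf' hτ (flipMap hσ τ x) = (σ.card / τ.card : ℝ) * μ := by
    obtain ⟨v, hvτ, hv0⟩ := Finset.exists_mem_eq_inf' hτ x
    apply le_antisymm
    · refine (Finset.inf'_le _ hvτ).trans ?_
      rw [hv v hvτ, ← hv0, h0, zero_add]
    · refine Finset.le_inf' hτ _ fun w hw => ?_
      rw [hv w hw]
      linarith [hx.1 w]
  ext v
  change (if v ∈ τ then flipMap hσ τ x v - τ.inf' hτ (flipMap hσ τ x)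
    else if v ∈ σ then flipMap hσ τ x v + (τ.card / σ.card : ℝ) * τ.inf' hτ (flipMap hσ τ x)
    else flipMap hσ τ x v) = x v
  rw [hinf]
  by_cases h1 : v ∈ τ
  · rw [if_pos h1, hv v h1]; ring
  · rw [if_neg h1]
    by_cases h2 : v ∈ σ
    · rw [if_pos h2]
      simp only [flipMap, if_pos h2, ← hμ]
      field_simp
      ring
    · rw [if_neg h2]
      simp [flipMap, h1, h2]

/-- The minimum over σ is linear on the part of each closed face where a chosen vertex of σ attains
it; these parts are the pieces. -/
theorem isPiecewiseLinear_flipMap {K : Set (Finset W)} (hK : IsLowerSet K) {σ : Finset W}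
    (hσ : σ.Nonempty) (τ : Finset W) {t : Set (W → ℝ)} (f : geomReal K → t)
    (hf : ∀ x, (f x : W → ℝ) = flipMap hσ τ x) : IsPiecewiseLinear f := by
  refine ⟨(fun p : Finset W × W => closedFace p.1 ∩
    {x | ∀ v : σ, 0 ≤ (LinearMap.proj (R := ℝ) (φ := fun _ : W => ℝ) v.1 -
      LinearMap.proj (R := ℝ) (φ := fun _ : W => ℝ) p.2) x}) ''
      (K ×ˢ (σ : Set W)), (Set.toFinite _).image _, ?_, ?_⟩
  · rw [← sUnion_closedFace hK]
    ext x
    simp only [Set.sUnion_image, Set.mem_iUnion, exists_prop, Prod.exists, Set.mem_prod]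
    constructor
    · rintro ⟨F, v, ⟨hF, -⟩, hx, -⟩
      exact ⟨F, hF, hx⟩
    · rintro ⟨F, hF, hx⟩
      obtain ⟨v, hv, hvx⟩ := Finset.exists_mem_eq_inf' hσ x
      refine ⟨F, v, ⟨hF, hv⟩, hx, fun w => ?_⟩
      have := Finset.inf'_le x w.2
      rw [hvx] at this
      simpa using this
  · rintro _ ⟨⟨F, u⟩, ⟨-, hu⟩, rfl⟩
    refine ⟨(isConvexPolyhedron_closedFace F).inter (isConvexPolyhedron_setOf_forall _), ?_⟩
    let A : (W → ℝ) →ₗ[ℝ] (W → ℝ) := LinearMap.pi fun v =>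
      if v ∈ σ then LinearMap.proj (R := ℝ) (φ := fun _ : W => ℝ) v -
        LinearMap.proj (R := ℝ) (φ := fun _ : W => ℝ) u
      else if v ∈ τ then LinearMap.proj (R := ℝ) (φ := fun _ : W => ℝ) v +
        (σ.card / τ.card : ℝ) • LinearMap.proj (R := ℝ) (φ := fun _ : W => ℝ) u
      else LinearMap.proj (R := ℝ) (φ := fun _ : W => ℝ) v
    refine ⟨A.toAffineMap, ?_⟩
    rintro ⟨x, hx⟩ ⟨-, hxu⟩
    have hinf : σ.inf' hσ x = x u := by
      refine le_antisymm (Finset.inf'_le x hu) (Finset.le_inf' hσ x fun v hv => ?_)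
      simpa using hxu ⟨v, hv⟩
    rw [hf]
    ext v
    simp only [flipMap, hinf, LinearMap.coe_toAffineMap, A, LinearMap.pi_apply]
    split_ifs <;> simp

/-- A bistellar flip does not change the piecewise linear homeomorphism type. -/
theorem IsFlippable.plHomeomorphic {K : Set (Finset W)} {σ τ : Finset W}
    (h : IsFlippable K σ τ) :
    PLHomeomorphic (geomReal (bistellarFlip K σ τ)) (geomReal K) := by
  have hmem : ∀ {x}, x ∈ geomReal (bistellarFlip K σ τ) →
      flipMap h.right_nonempty σ x ∈ geomReal K := by
    intro x hx
    have := h.symm.flipMap_mem hx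
    rwa [h.flip_flip] at this
  let φ : geomReal (bistellarFlip K σ τ) ≃ₜ geomReal K :=
    { toFun := fun x => ⟨flipMap h.right_nonempty σ x, hmem x.2⟩
      invFun := fun x => ⟨flipMap h.left_nonempty τ x, h.flipMap_mem x.2⟩
      left_inv := fun x => Subtype.ext (h.symm.flipMap_flipMap x.2)
      right_inv := fun x => Subtype.ext (h.flipMap_flipMap x.2)
      continuous_toFun := by
        refine Continuous.subtype_mk ?_ _
        exact (continuous_flipMap _ _).comp continuous_subtype_val
      continuous_invFun := by
        refine Continuous.subtype_mk ?_ _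
        exact (continuous_flipMap _ _).comp continuous_subtype_val }
  exact ⟨φ, isPiecewiseLinear_flipMap h.isLowerSet_flip _ _ _ fun _ => rfl,
    isPiecewiseLinear_flipMap h.lower _ _ _ fun _ => rfl⟩

end FlipReal

/-! ### Sphere families on an arbitrary vertex type, and their transfer to `Fin n`. -/

section Families

variable {V : Type} [DecidableEq V]

/-- The subsets of `W` whose image under `e` belongs to `K`. -/
def pullFamily {W : Type} (e : W ↪ V) (K : Set (Finset V)) : Set (Finset W) :=
  {F | F.map e ∈ K}

/-- A family of finite sets all of whose realizations in coordinate spaces containing its vertices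
are piecewise linear `d`-spheres. -/
def IsPLSphereFamily (K : Set (Finset V)) (d : ℕ) : Prop :=
  ∀ (W : Type) [Fintype W] (e : W ↪ V), (∀ F ∈ K, ∀ v ∈ F, ∃ w, e w = v) →
    PLHomeomorphic (geomReal (pullFamily e K))
      (AbstractSimplicialComplex.simplexBoundary d).realization

omit [DecidableEq V] in
theorem isLowerSet_pullFamily {W : Type} (e : W ↪ V) {K : Set (Finset V)} (hK : IsLowerSet K) :
    IsLowerSet (pullFamily e K) := by
  intro F G hGF hF
  exact hK (Finset.map_subset_map.2 hGF) hF

omit [DecidableEq V] in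
theorem exists_map_eq {W : Type} (e : W ↪ V) {F : Finset V} (hF : ∀ v ∈ F, ∃ w, e w = v) :
    ∃ G : Finset W, G.map e = F := by
  classical
  refine ⟨F.preimage e e.injective.injOn, ?_⟩
  ext v
  simp only [Finset.mem_map, Finset.mem_preimage]
  constructor
  · rintro ⟨w, hw, rfl⟩; exact hw
  · intro hv
    obtain ⟨w, rfl⟩ := hF v hv
    exact ⟨w, hv, rfl⟩

/-- The bound `2 ≤ σ.card` keeps every vertex of K a vertex after the flip, so that coordinates
covering the new family also cover K. A flip may create a vertex but never deletes one here. -/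
theorem IsPLSphereFamily.flip {K : Set (Finset V)} {d : ℕ} (hK : IsPLSphereFamily K d)
    {σ τ : Finset V} (h : IsFlippable K σ τ) (hσ : 2 ≤ σ.card) :
    IsPLSphereFamily (bistellarFlip K σ τ) d := by
  intro W _ e he
  classical
  have hns : ∀ v, ¬ σ ⊆ {v} := fun v hv => by
    have := Finset.card_le_card hv
    simp at this; omega
  have hKe : ∀ F ∈ K, ∀ v ∈ F, ∃ w, e w = v := by
    intro F hF v hv
    refine he {v} (Or.inl ⟨h.lower ?_ hF, hns v⟩) v (by simp)
    simpa using hv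
  obtain ⟨a, ha⟩ := h.left_nonempty
  obtain ⟨σ', rfl⟩ := exists_map_eq e (F := σ) (fun v hv => by
    refine hKe σ (h.mem σ Finset.subset_union_left fun hs => ?_) v hv
    obtain ⟨b, hb⟩ := h.right_nonempty
    exact Finset.disjoint_left.1 h.disj (hs hb) hb)
  obtain ⟨τ', rfl⟩ := exists_map_eq e (F := τ) (fun v hv => by
    refine he τ (Or.inr ⟨subset_rfl, Finset.subset_union_right, fun hs => ?_⟩) v hv
    exact Finset.disjoint_left.1 h.disj ha (hs ha))
  have hflip : IsFlippable (pullFamily e K) σ' τ' :=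
    { lower := isLowerSet_pullFamily e h.lower
      disj := (Finset.disjoint_map e).1 h.disj
      left_nonempty := Finset.map_nonempty.1 h.left_nonempty
      right_nonempty := Finset.map_nonempty.1 h.right_nonempty
      star := fun F hF hs => by
        have := h.star _ hF (Finset.map_subset_map.2 hs)
        rwa [← Finset.map_union, Finset.map_subset_map] at this
      mem := fun F hF hs => by
        refine h.mem _ ?_ fun h' => hs (Finset.map_subset_map.1 h')
        rwa [← Finset.map_union, Finset.map_subset_map]
      notMem := h.notMem }
  have heq : pullFamily e (bistellarFlip K (σ'.map e) (τ'.map e)) =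
      bistellarFlip (pullFamily e K) σ' τ' := by
    ext F
    simp only [pullFamily, bistellarFlip, Set.mem_ofPred_eq, ← Finset.map_union,
      Finset.map_subset_map]
  rw [heq]
  exact hflip.plHomeomorphic.trans (hK W e hKe)

omit [DecidableEq V] in
theorem isPLSphereFamily_boundary {S : Finset V} {d : ℕ} (hS : S.card = d + 2) :
    IsPLSphereFamily {F | F ⊆ S ∧ F ≠ S} d := by
  classical
  intro W _ e he
  have hSe : ∀ v ∈ S, ∃ w, e w = v := by
    intro v hv
    refine he {v} ⟨by simpa using hv, fun h => ?_⟩ v (by simp)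
    rw [← h] at hS
    simp at hS
  let φ := (S.equivFinOfCardEq hS).symm
  choose g hg using fun i => hSe (φ i) (φ i).2
  let e' : Fin (d + 2) ↪ W := ⟨g, fun i j hij => by
    have : (φ i : V) = φ j := by rw [← hg, ← hg, hij]
    exact φ.injective (Subtype.ext this)⟩
  have hmap : (Finset.univ.map e').map e = S := by
    ext v
    simp only [Finset.mem_map, Finset.mem_univ, true_and, exists_exists_eq_and]
    constructor
    · rintro ⟨i, rfl⟩
      change e (g i) ∈ S
      rw [hg]; exact (φ i).2
    · intro hv
      refine ⟨φ.symm ⟨v, hv⟩, ?_⟩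
      change e (g _) = v
      rw [hg]; simp
  have h1 : (AbstractSimplicialComplex.simplexBoundary d).realization =
      geomReal {F | F ≠ Finset.univ} := by
    rw [← geomReal_eq_of_nonempty]; rfl
  rw [h1]
  refine geomReal_plHomeomorphic_of_embedding e' ?_ (isLowerSet_pullFamily e ?_) ?_
  · intro F G hGF hF hG
    exact hF (Finset.univ_subset_iff.1 (hG ▸ hGF))
  · rintro F G hGF ⟨h1, h2⟩
    have hGF : G ⊆ F := hGF
    exact ⟨hGF.trans h1, fun h => h2 (Finset.Subset.antisymm h1 (h ▸ hGF))⟩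
  · intro F
    simp only [pullFamily, Set.mem_ofPred_eq]
    rw [← hmap]
    simp only [Finset.map_subset_map, ne_eq, Finset.map_inj]
    constructor
    · rintro ⟨h1, h2⟩
      obtain ⟨G, rfl⟩ := exists_map_eq e' (F := F) fun v hv => by
        simpa using h1 hv
      exact ⟨G, fun h => h2 (h ▸ rfl), rfl⟩
    · rintro ⟨G, hG, rfl⟩
      exact ⟨Finset.map_subset_map.2 (Finset.subset_univ _), fun h => hG (Finset.map_injective e' h)⟩

/-- The missing tetrahedra of a family of finite sets. -/
def missingTetra (K : Set (Finset V)) : Set (Finset V) :=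
  {F | F.card = 4 ∧ F ∉ K ∧ ∀ G ⊂ F, G ∈ K}

omit [DecidableEq V] in
-- This is the exit from the construction, which lives on the infinite label set ℤ ⊕ ℤ. The label
-- set X is numbered by `Fin n`; all its elements are vertices because, for n ≥ 2, each lies in an
-- edge.
theorem exists_complex_of_family {K : Set (Finset V)} {X : Finset V} {n m : ℕ}
    (hX : X.card = n) (hlow : IsLowerSet K) (hKX : ∀ F ∈ K, F ⊆ X) (hne : 2 ≤ n)
    (hedge : ∀ F ⊆ X, F.card = 2 → F ∈ K)
    (hPL : IsPLSphereFamily K 4) (hm : (missingTetra K).ncard = m) :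
    ∃ Δ : AbstractSimplicialComplex (Fin n),
      Δ.IsPLSphere 4 ∧ Δ.IsNeighborly 2 ∧ Δ.missingFaceCount 3 = m := by
  classical
  let e : Fin n ↪ V := (X.equivFinOfCardEq hX).symm.toEmbedding.trans (Function.Embedding.subtype _)
  have heX : ∀ i, e i ∈ X := fun i => ((X.equivFinOfCardEq hX).symm i).2
  have hemap : ∀ F : Finset (Fin n), F.map e ⊆ X := by
    intro F v hv
    obtain ⟨i, -, rfl⟩ := Finset.mem_map.1 hv
    exact heX i
  have hcov : ∀ v ∈ X, ∃ i, e i = v := fun v hv =>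
    ⟨X.equivFinOfCardEq hX ⟨v, hv⟩, by simp [e]⟩
  have hlow' := isLowerSet_pullFamily e hlow
  have hpull2 : ∀ F : Finset (Fin n), F.card = 2 → F ∈ pullFamily e K := fun F hF =>
    hedge _ (hemap F) (by simpa using hF)
  have hpull1 : ∀ i : Fin n, {i} ∈ pullFamily e K := by
    intro i
    obtain ⟨F, hF, hF2⟩ := Finset.exists_superset_card_eq (s := {i}) (n := 2) (by simp)
      (by simpa using hne)
    exact hlow' hF (hpull2 F hF2)
  have hpull0 : ∅ ∈ pullFamily e K :=
    hlow' (Finset.empty_subset {⟨0, by omega⟩}) (hpull1 ⟨0, by omega⟩)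
  let Δ : AbstractSimplicialComplex (Fin n) :=
    { faces := {F | F.Nonempty ∧ F ∈ pullFamily e K}
      isRelLowerSet_faces := by
        intro F hF
        exact ⟨hF.1, fun G hGF hG => ⟨hG, hlow' hGF hF.2⟩⟩
      singleton_mem := fun i => ⟨by simp, hpull1 i⟩ }
  have hface : ∀ F, Δ.IsFace F ↔ F.map e ∈ K := by
    intro F
    constructor
    · rintro (rfl | h)
      exacts [hpull0, h.2]
    · intro h
      rcases F.eq_empty_or_nonempty with h0 | h0
      exacts [Or.inl h0, Or.inr ⟨h0, h⟩]
  have hcount : ∀ k, (∀ F : Finset (Fin n), F.card = k → F ∈ pullFamily e K) →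
      Δ.faceCount k = n.choose k := by
    intro k hk
    have : {F : Finset (Fin n) | Δ.IsFace F ∧ F.card = k} =
        ↑((Finset.univ : Finset (Fin n)).powersetCard k) := by
      ext F
      simp only [Set.mem_ofPred_eq, hface, Finset.mem_coe, Finset.mem_powersetCard_univ]
      exact ⟨fun h => h.2, fun h => ⟨hk F h, h⟩⟩
    rw [AbstractSimplicialComplex.faceCount, this, Set.ncard_coe_finset, Finset.card_powersetCard]
    simp
  refine ⟨Δ, ?_, ?_, ?_⟩
  · have h1 : Δ.realization = geomReal (pullFamily e K) := by
      rw [← geomReal_eq_of_nonempty]; rfl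
    change PLHomeomorphic Δ.realization _
    rw [h1]
    exact hPL (Fin n) e fun F hF v hv => hcov v (hKX F hF hv)
  · rw [AbstractSimplicialComplex.IsNeighborly, hcount 2 hpull2, hcount 1, Nat.choose_one_right]
    intro F hF
    obtain ⟨i, rfl⟩ := Finset.card_eq_one.1 hF
    exact hpull1 i
  · rw [← hm, AbstractSimplicialComplex.missingFaceCount,
      ← Set.ncard_image_of_injective _ (Finset.map_injective e)]
    congr 1
    ext F
    constructor
    · rintro ⟨G, ⟨⟨hG1, hG2⟩, hG3⟩, rfl⟩
      refine ⟨by simpa using hG3, fun h => hG1 ((hface G).2 h), fun H hH => ?_⟩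
      obtain ⟨H', rfl⟩ := exists_map_eq e (F := H) fun v hv => hcov v (hemap G (hH.1 hv))
      exact (hface _).1 (hG2 H' (Finset.map_ssubset_map.1 hH))
    · rintro ⟨h1, h2, h3⟩
      have hFX : F ⊆ X := by
        intro v hv
        refine hKX {v} (h3 {v} ?_) (by simp)
        refine Finset.ssubset_iff_subset_ne.2 ⟨by simpa using hv, fun h => ?_⟩
        rw [← h] at h1
        simp at h1
      obtain ⟨G, rfl⟩ := exists_map_eq e (F := F) fun v hv => hcov v (hFX hv)
      refine ⟨G, ⟨⟨fun h => h2 ((hface G).1 h), fun H hH => (hface H).2 (h3 _ ?_)⟩, ?_⟩, rfl⟩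
      · exact Finset.map_ssubset_map.2 hH
      · simpa using h1

end Families

/-! ### Regions in the join of two paths; replacing a cone by flips along a shelling. -/

section Grid

open Sum

/-- The vertices of the cell of the integer grid with lower left corner `(i, j)`: two consecutive
horizontal and two consecutive vertical coordinates. -/
def gridCell (i j : ℤ) : Finset (ℤ ⊕ ℤ) := {inl i, inl (i + 1), inr j, inr (j + 1)}

@[simp] theorem inl_mem_gridCell {x i j : ℤ} : inl x ∈ gridCell i j ↔ x = i ∨ x = i + 1 := by
  simp [gridCell]

@[simp] theorem inr_mem_gridCell {y i j : ℤ} : inr y ∈ gridCell i j ↔ y = j ∨ y = j + 1 := by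
  simp [gridCell]

theorem card_gridCell (i j : ℤ) : (gridCell i j).card = 4 := by
  simp [gridCell, Finset.card_insert_of_notMem]

/-- `F` is contained in a cell of the region `R`. -/
def InRegion (R : ℤ → ℤ → Prop) (F : Finset (ℤ ⊕ ℤ)) : Prop := ∃ i j, R i j ∧ F ⊆ gridCell i j

/-- `F` is an interior face of the region `R`. -/
structure InInterior (R : ℤ → ℤ → Prop) (F : Finset (ℤ ⊕ ℤ)) : Prop where
  left : ∃ i, inl i ∈ F
  right : ∃ j, inr j ∈ F
  face : ∃ i j, F ⊆ gridCell i j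
  cells : ∀ i j, F ⊆ gridCell i j → R i j

theorem InInterior.inRegion {R : ℤ → ℤ → Prop} {F : Finset (ℤ ⊕ ℤ)} (h : InInterior R F) :
    InRegion R F := by
  obtain ⟨i, j, hij⟩ := h.face
  exact ⟨i, j, h.cells i j hij, hij⟩

theorem InRegion.mono {R R' : ℤ → ℤ → Prop} (hR : ∀ i j, R i j → R' i j) {F G : Finset (ℤ ⊕ ℤ)}
    (hFG : F ⊆ G) (h : InRegion R G) : InRegion R' F := by
  obtain ⟨i, j, hij, hG⟩ := h
  exact ⟨i, j, hR i j hij, hFG.trans hG⟩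

theorem InInterior.mono {R R' : ℤ → ℤ → Prop} (hR : ∀ i j, R i j → R' i j)
    {F : Finset (ℤ ⊕ ℤ)} (h : InInterior R F) : InInterior R' F :=
  ⟨h.left, h.right, h.face, fun i j hij => hR i j (h.cells i j hij)⟩

theorem InInterior.of_subset {R : ℤ → ℤ → Prop} {F G : Finset (ℤ ⊕ ℤ)} (h : InInterior R F)
    (hFG : F ⊆ G) (hG : ∃ i j, G ⊆ gridCell i j) : InInterior R G :=
  ⟨h.left.imp fun _ hi => hFG hi, h.right.imp fun _ hj => hFG hj, hG,
    fun i j hij => h.cells i j (hFG.trans hij)⟩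

/-- The cone with apex `w` over the region `R` is contained in `K`, and the star of each of its
interior faces is contained in that cone. -/
structure IsConeIn (K : Set (Finset (ℤ ⊕ ℤ))) (w : ℤ ⊕ ℤ) (R : ℤ → ℤ → Prop) : Prop where
  lower : IsLowerSet K
  notMem : ∀ i j, R i j → w ∉ gridCell i j
  cell_mem : ∀ i j, R i j → insert w (gridCell i j) ∈ K
  star : ∀ F G, InInterior R F → F ⊆ G → w ∈ G → G ∈ K → InRegion R (G.erase w)

/-- `G` is an interior face of the cone with apex `w` over the region `R`. -/
def InConeInterior (w : ℤ ⊕ ℤ) (R : ℤ → ℤ → Prop) (G : Finset (ℤ ⊕ ℤ)) : Prop :=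
  w ∈ G ∧ InInterior R (G.erase w)

/-- The family obtained from `K` by replacing the cone with apex `w` over the region `C` by the
cone with apex `w'` over its boundary. -/
def reconed (K : Set (Finset (ℤ ⊕ ℤ))) (w w' : ℤ ⊕ ℤ) (C : ℤ → ℤ → Prop) :
    Set (Finset (ℤ ⊕ ℤ)) :=
  {G | (w' ∉ G ∧ G ∈ K ∧ ¬ InConeInterior w C G) ∨
    (w' ∈ G ∧ InRegion C ((G.erase w').erase w) ∧ ¬ InConeInterior w C (G.erase w'))}

/-- The region `C` with one further cell. -/
def addCell (C : ℤ → ℤ → Prop) (a b : ℤ) : ℤ → ℤ → Prop := fun i j => C i j ∨ (i = a ∧ j = b)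

/-- `S` is the restriction face of the cell `(a, b)` when it is added to `C` in a shelling. -/
structure IsShellingStep (C : ℤ → ℤ → Prop) (a b : ℤ) (S : Finset (ℤ ⊕ ℤ)) : Prop where
  notMem : ¬ C a b
  subset : S ⊆ gridCell a b
  inRegion_iff : ∀ F, F ⊆ gridCell a b → (InRegion C F ↔ ¬ S ⊆ F)
  interior : InInterior (addCell C a b) (gridCell a b \ S)

/-- The paths are infinite in both directions, so each triangle of a cell is shared with a
neighbouring cell, one step away from the deleted vertex. -/
theorem exists_gridCell_erase (a b : ℤ) (v : ℤ ⊕ ℤ) (hv : v ∈ gridCell a b) :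
    ∃ i j, (i ≠ a ∨ j ≠ b) ∧ (gridCell a b).erase v ⊆ gridCell i j := by
  rcases v with x | y
  · rcases inl_mem_gridCell.1 hv with rfl | rfl
    · refine ⟨x + 1, b, by omega, ?_⟩
      rintro (u | u) hu <;> simp at hu ⊢ <;> omega
    · refine ⟨a - 1, b, by omega, ?_⟩
      rintro (u | u) hu <;> simp at hu ⊢ <;> omega
  · rcases inr_mem_gridCell.1 hv with rfl | rfl
    · refine ⟨a, y + 1, by omega, ?_⟩
      rintro (u | u) hu <;> simp at hu ⊢ <;> omega
    · refine ⟨a, b - 1, by omega, ?_⟩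
      rintro (u | u) hu <;> simp at hu ⊢ <;> omega

/-- If F omits a vertex v of `gridCell a b \ S`, it lies in the triangle opposite v. That triangle
contains S, so it is not in C, and the cell across it is outside the enlarged region. Hence F is not
interior. -/
theorem IsShellingStep.interior_iff {C : ℤ → ℤ → Prop} {a b : ℤ} {S : Finset (ℤ ⊕ ℤ)}
    (h : IsShellingStep C a b S) (F : Finset (ℤ ⊕ ℤ)) :
    InInterior (addCell C a b) F ↔
      InInterior C F ∨ (gridCell a b \ S ⊆ F ∧ F ⊆ gridCell a b) := by
  constructor
  · intro hF
    by_cases hFc : F ⊆ gridCell a b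
    · refine Or.inr ⟨fun v hv => ?_, hFc⟩
      by_contra hvF
      obtain ⟨hvc, hvS⟩ := Finset.mem_sdiff.1 hv
      obtain ⟨i, j, hij, hsub⟩ := exists_gridCell_erase a b v hvc
      have hFv : F ⊆ (gridCell a b).erase v := Finset.subset_erase.2 ⟨hFc, hvF⟩
      rcases hF.cells i j (hFv.trans hsub) with hC | hC
      · refine (h.inRegion_iff _ (Finset.erase_subset _ _)).1 ⟨i, j, hC, hsub⟩ ?_
        exact Finset.subset_erase.2 ⟨h.subset, hvS⟩
      · omega
    · refine Or.inl ⟨hF.left, hF.right, hF.face, fun i j hij => ?_⟩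
      rcases hF.cells i j hij with hC | ⟨rfl, rfl⟩
      exacts [hC, absurd hij hFc]
  · rintro (hF | ⟨h1, h2⟩)
    · exact hF.mono fun i j hij => Or.inl hij
    · exact h.interior.of_subset h1 ⟨a, b, h2⟩

theorem inRegion_addCell {C : ℤ → ℤ → Prop} {a b : ℤ} {F : Finset (ℤ ⊕ ℤ)} :
    InRegion (addCell C a b) F ↔ InRegion C F ∨ F ⊆ gridCell a b := by
  constructor
  · rintro ⟨i, j, hC | ⟨rfl, rfl⟩, hF⟩
    exacts [Or.inl ⟨i, j, hC, hF⟩, Or.inr hF]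
  · rintro (⟨i, j, hC, hF⟩ | hF)
    exacts [⟨i, j, Or.inl hC, hF⟩, ⟨a, b, Or.inr ⟨rfl, rfl⟩, hF⟩]

/-- A face over the interior face `gridCell a b \ S` that is not interior to the old region lies
in the new cell. -/
theorem IsShellingStep.subset_gridCell {C : ℤ → ℤ → Prop} {a b : ℤ} {S : Finset (ℤ ⊕ ℤ)}
    (h : IsShellingStep C a b S) {A : Finset (ℤ ⊕ ℤ)} (hA : gridCell a b \ S ⊆ A)
    (hf : ∃ i j, A ⊆ gridCell i j) (hni : ¬ InInterior C A) : A ⊆ gridCell a b := by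
  rcases (h.interior_iff A).1 (h.interior.of_subset hA hf) with h1 | h1
  exacts [absurd h1 hni, h1.2]

section Flip

variable {K : Set (Finset (ℤ ⊕ ℤ))} {w w' : ℤ ⊕ ℤ} {R C : ℤ → ℤ → Prop} {a b : ℤ}
  {S : Finset (ℤ ⊕ ℤ)}

theorem insert_gridCell_sdiff_subset_iff (hw : w ∉ gridCell a b) {G : Finset (ℤ ⊕ ℤ)} :
    insert w (gridCell a b \ S) ⊆ G ↔ w ∈ G ∧ gridCell a b \ S ⊆ G.erase w := by
  rw [Finset.insert_subset_iff, Finset.subset_erase]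
  have : w ∉ gridCell a b \ S := fun hh => hw (Finset.mem_sdiff.1 hh).1
  tauto

/-- Adding the cell makes interior exactly the faces of the cone that contain w ∪ (cell \ S) and no
vertex outside the cell and w, so these are deleted. The cone from w' gains exactly the faces over
w' ∪ S. Both sets lie in the six vertices formed by w, w' and the cell, which is the pattern of a
bistellar flip. -/
theorem IsConeIn.isFlippable_reconed (hK : IsConeIn K w R) (hw' : ∀ F ∈ K, w' ∉ F)
    (hCR : ∀ i j, C i j → R i j) (hab : R a b) (h : IsShellingStep C a b S)
    (hlow : IsLowerSet (reconed K w w' C)) :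
    IsFlippable (reconed K w w' C) (insert w (gridCell a b \ S)) (insert w' S) ∧
      bistellarFlip (reconed K w w' C) (insert w (gridCell a b \ S)) (insert w' S) =
        reconed K w w' (addCell C a b) := by
  have hw := hK.notMem a b hab
  have hw'c : w' ∉ insert w (gridCell a b) := hw' _ (hK.cell_mem a b hab)
  have hww' : w' ≠ w := fun hh => hw'c (by simp [hh])
  have hw'c' : w' ∉ gridCell a b := fun hh => hw'c (Finset.mem_insert_of_mem hh)
  have hwS : w ∉ S := fun hh => hw (h.subset hh)
  have hw'S : w' ∉ S := fun hh => hw'c' (h.subset hh)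
  have hCR' : ∀ i j, addCell C a b i j → R i j := by
    rintro i j (hC | ⟨rfl, rfl⟩)
    exacts [hCR i j hC, hab]
  have hunion : insert w (gridCell a b \ S) ∪ insert w' S =
      insert w' (insert w (gridCell a b)) := by
    ext v
    have := @h.subset v
    simp only [Finset.mem_union, Finset.mem_insert, Finset.mem_sdiff]
    tauto
  have hsubU : ∀ G, G ⊆ insert w' (insert w (gridCell a b)) ↔
      (G.erase w').erase w ⊆ gridCell a b := fun G => by
    rw [Finset.subset_insert_iff, Finset.subset_insert_iff]
  have hτ : ∀ G, insert w' S ⊆ G ↔ w' ∈ G ∧ S ⊆ (G.erase w').erase w := fun G => by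
    rw [Finset.insert_subset_iff, Finset.subset_erase, Finset.subset_erase]
    tauto
  have hσ : ∀ G, insert w (gridCell a b \ S) ⊆ G ↔
      w ∈ G.erase w' ∧ gridCell a b \ S ⊆ (G.erase w').erase w := fun G => by
    rw [insert_gridCell_sdiff_subset_iff hw, Finset.subset_erase, Finset.subset_erase, Finset.subset_erase,
      Finset.mem_erase]
    have : w' ∉ gridCell a b \ S := fun hh => hw'c' (Finset.mem_sdiff.1 hh).1
    tauto
  have hnint : ∀ A, A ⊆ gridCell a b → ¬ InInterior C A := fun A hA hi =>
    h.notMem (hi.cells a b hA)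
  -- The star condition of the cone guarantees that no face of K over the flipped face leaves the
  -- grid.
  have hstar : ∀ G, G ∈ K → w ∈ G → gridCell a b \ S ⊆ G.erase w →
      ∃ i j, G.erase w ⊆ gridCell i j := by
    intro G hG hwG hs
    obtain ⟨i, j, -, hij⟩ := hK.star _ G (h.interior.mono hCR')
      (hs.trans (Finset.erase_subset _ _)) hwG hG
    exact ⟨i, j, hij⟩
  refine ⟨⟨hlow, ?_, by simp, by simp, ?_, ?_, ?_⟩, ?_⟩
  · rw [Finset.disjoint_left]
    intro v hv hv'
    rw [Finset.mem_insert, Finset.mem_sdiff] at hv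
    rw [Finset.mem_insert] at hv'
    rcases hv with rfl | ⟨hv1, hv2⟩ <;> rcases hv' with rfl | hv'
    exacts [hww' rfl, hwS hv', hw'c' hv1, hv2 hv']
  · intro G hG hs
    rw [hunion, hsubU]
    obtain ⟨hwG, hs⟩ := (hσ G).1 hs
    rcases hG with ⟨h1, h2, h3⟩ | ⟨h1, ⟨i, j, -, h2⟩, h3⟩
    · rw [Finset.erase_eq_of_notMem h1] at hwG hs ⊢
      exact h.subset_gridCell hs (hstar G h2 hwG hs) fun hi => h3 ⟨hwG, hi⟩
    · exact h.subset_gridCell hs ⟨i, j, h2⟩ fun hi => h3 ⟨hwG, hi⟩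
  · intro G hG hs
    rw [hunion] at hG
    have hG' := (hsubU G).1 hG
    by_cases hwG : w' ∈ G
    · refine Or.inr ⟨hwG, ?_, fun hi => hnint _ hG' hi.2⟩
      rw [h.inRegion_iff _ hG']
      exact fun hh => hs ((hτ G).2 ⟨hwG, hh⟩)
    · rw [Finset.erase_eq_of_notMem hwG] at hG'
      refine Or.inl ⟨hwG, hK.lower ?_ (hK.cell_mem a b hab), fun hi => hnint _ hG' hi.2⟩
      exact Finset.subset_insert_iff.2 hG'
  · rintro (⟨h1, -, -⟩ | ⟨-, h2, -⟩)
    · simp at h1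
    · rw [Finset.erase_insert hw'S, Finset.erase_eq_of_notMem hwS, h.inRegion_iff _ h.subset] at h2
      exact h2 subset_rfl
  · ext G
    simp only [bistellarFlip, reconed, Set.mem_ofPred_eq, hunion, hτ, hσ, hsubU,
      InConeInterior, h.interior_iff, inRegion_addCell]
    by_cases hwG : w' ∈ G
    · simp only [hwG, not_true_eq_false, false_and, true_and, false_or]
      have h1 := h.inRegion_iff ((G.erase w').erase w)
      have h2 : InRegion C ((G.erase w').erase w) → gridCell a b \ S ⊆ (G.erase w').erase w →
          ¬ InInterior C ((G.erase w').erase w) → (G.erase w').erase w ⊆ gridCell a b :=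
        fun ⟨i, j, _, h3⟩ h4 h5 => h.subset_gridCell h4 ⟨i, j, h3⟩ h5
      have h3 := hnint ((G.erase w').erase w)
      clear hnint hstar hσ hτ hsubU hunion
      generalize InRegion C ((G.erase w').erase w) = p1 at *
      generalize InInterior C ((G.erase w').erase w) = p2 at *
      generalize (gridCell a b \ S ⊆ (G.erase w').erase w) = p3 at *
      generalize ((G.erase w').erase w ⊆ gridCell a b) = p4 at *
      generalize (S ⊆ (G.erase w').erase w) = p5 at *
      generalize (w ∈ G.erase w') = p6 at *
      clear * - h1 h2 h3
      by_cases p1 <;> by_cases p4 <;> simp_all; tauto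
    · simp only [hwG, not_false_eq_true, false_and, true_and, or_false,
        Finset.erase_eq_of_notMem hwG]
      constructor
      · rintro ⟨⟨h1, h2⟩, h3⟩
        exact ⟨h1, by tauto⟩
      · rintro ⟨h1, h2⟩
        refine ⟨⟨h1, by tauto⟩, ?_⟩
        rintro ⟨h3, h4⟩
        have h5 := hstar G h1 h3 h4
        have := h.subset_gridCell h4 h5
        tauto

end Flip

/-- Regions that can be shelled cell by cell. -/
inductive IsShellable : (ℤ → ℤ → Prop) → Prop
  | empty : IsShellable fun _ _ => False
  | add {C : ℤ → ℤ → Prop} {a b : ℤ} {S : Finset (ℤ ⊕ ℤ)} : IsShellable C →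
      IsShellingStep C a b S → IsShellable (addCell C a b)

theorem IsConeIn.reconed_empty {K : Set (Finset (ℤ ⊕ ℤ))} {w w' : ℤ ⊕ ℤ}
    (hw' : ∀ F ∈ K, w' ∉ F) : reconed K w w' (fun _ _ => False) = K := by
  ext G
  have h1 : ∀ A, ¬ InInterior (fun _ _ => False) A := fun A hA => by
    obtain ⟨i, j, hij⟩ := hA.face
    exact hA.cells i j hij
  have h2 : ∀ A, ¬ InRegion (fun _ _ => False) A := by rintro A ⟨i, j, h, -⟩; exact h
  simp only [reconed, InConeInterior, h1, h2, Set.mem_ofPred_eq]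
  have := hw' G
  tauto

theorem IsConeIn.reconed_of_isShellable {K : Set (Finset (ℤ ⊕ ℤ))} {w w' : ℤ ⊕ ℤ}
    {R C : ℤ → ℤ → Prop} {d : ℕ} (hK : IsConeIn K w R) (hw' : ∀ F ∈ K, w' ∉ F)
    (hC : IsShellable C) (hCR : ∀ i j, C i j → R i j) (hPL : IsPLSphereFamily K d) :
    IsLowerSet (reconed K w w' C) ∧ IsPLSphereFamily (reconed K w w' C) d := by
  induction hC with
  | empty =>
    rw [IsConeIn.reconed_empty hw']
    exact ⟨hK.lower, hPL⟩
  | @add C a b S _ hstep ih =>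
    have hab := hCR a b (Or.inr ⟨rfl, rfl⟩)
    obtain ⟨h1, h2⟩ := ih fun i j hij => hCR i j (Or.inl hij)
    obtain ⟨hf, heq⟩ := hK.isFlippable_reconed hw' (fun i j hij => hCR i j (Or.inl hij)) hab
      hstep h1
    rw [← heq]
    refine ⟨hf.isLowerSet_flip, h2.flip hf ?_⟩
    obtain ⟨i, hi⟩ := hstep.interior.left
    rw [Finset.card_insert_of_notMem fun hh => hK.notMem a b hab (Finset.mem_sdiff.1 hh).1]
    have := Finset.card_pos.2 ⟨_, hi⟩
    omega

end Grid

/-! ### Shelling staircases, and the effect of one sewing step. -/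

section Step

open Sum

/-- The region consisting of the columns `x₀, …, k - 1`, between heights `y₀` and `t`, and of
column `k`, between heights `y₀` and `s`. -/
def staircase (x₀ y₀ t k s : ℤ) : ℤ → ℤ → Prop := fun i j =>
  (x₀ ≤ i ∧ i < k ∧ y₀ ≤ j ∧ j < t) ∨ (i = k ∧ y₀ ≤ j ∧ j < s)

theorem isShellingStep_staircase {x₀ y₀ t k s : ℤ} (hk : x₀ ≤ k) (hs : y₀ ≤ s) (hst : s < t) :
    ∃ S, IsShellingStep (staircase x₀ y₀ t k s) k s S := by
  classical
  -- Cells are added column by column, each from bottom to top. Deleting `inl (k + 1)` leaves the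
  -- triangle shared with the cell on the left, deleting `inr (s + 1)` the one shared with the cell
  -- below; S collects those of these vertices for which that neighbour is present.
  let S : Finset (ℤ ⊕ ℤ) := (if x₀ < k then {inl (k + 1)} else ∅) ∪
    (if y₀ < s then {inr (s + 1)} else ∅)
  have hSl : ∀ x, inl x ∈ S ↔ x = k + 1 ∧ x₀ < k := fun x => by
    simp only [S]; split_ifs <;> simp [*]
  have hSr : ∀ x, inr x ∈ S ↔ x = s + 1 ∧ y₀ < s := fun x => by
    simp only [S]; split_ifs <;> simp [*]
  clear_value S
  refine ⟨S, ?_, ?_, ?_, ?_⟩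
  · simp only [staircase]; omega
  · rintro (u | u) hu
    · rw [hSl] at hu; simp; omega
    · rw [hSr] at hu; simp; omega
  · intro F hF
    constructor
    · rintro ⟨i, j, hij, hFij⟩ hSF
      have h1 : x₀ < k → k + 1 = i ∨ k + 1 = i + 1 := fun h =>
        inl_mem_gridCell.1 (hFij (hSF ((hSl _).2 ⟨rfl, h⟩)))
      have h2 : y₀ < s → s + 1 = j ∨ s + 1 = j + 1 := fun h =>
        inr_mem_gridCell.1 (hFij (hSF ((hSr _).2 ⟨rfl, h⟩)))
      simp only [staircase] at hij
      omega
    · intro hSF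
      obtain ⟨v, hv, hvF⟩ := Finset.not_subset.1 hSF
      rcases v with x | x
      · obtain ⟨rfl, hx⟩ := (hSl x).1 hv
        refine ⟨k - 1, s, by simp only [staircase]; omega, ?_⟩
        rintro (u | u) hu
        · have := inl_mem_gridCell.1 (hF hu)
          have : u ≠ k + 1 := by rintro rfl; exact hvF hu
          simp; omega
        · simpa using hF hu
      · obtain ⟨rfl, hx⟩ := (hSr x).1 hv
        refine ⟨k, s - 1, Or.inr ⟨rfl, by omega, by omega⟩, ?_⟩
        rintro (u | u) hu
        · simpa using hF hu
        · have := inr_mem_gridCell.1 (hF hu)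
          have : u ≠ s + 1 := by rintro rfl; exact hvF hu
          simp; omega
  · have hk0 : inl k ∈ gridCell k s \ S := by simp [hSl]
    have hs0 : inr s ∈ gridCell k s \ S := by simp [hSr]
    refine ⟨⟨k, hk0⟩, ⟨s, hs0⟩, ⟨k, s, Finset.sdiff_subset⟩, fun i j hij => ?_⟩
    have h1 := inl_mem_gridCell.1 (hij hk0)
    have h2 := inr_mem_gridCell.1 (hij hs0)
    have h3 : ¬ x₀ < k → k + 1 = i ∨ k + 1 = i + 1 := fun h =>
      inl_mem_gridCell.1 (hij (by simp [hSl, h]))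
    have h4 : ¬ y₀ < s → s + 1 = j ∨ s + 1 = j + 1 := fun h =>
      inr_mem_gridCell.1 (hij (by simp [hSr, h]))
    simp only [addCell, staircase]
    omega

theorem isShellable_staircase {x₀ y₀ t k s : ℤ} (hk : x₀ ≤ k) (hs : y₀ ≤ s) (hst : s ≤ t) :
    IsShellable (staircase x₀ y₀ t k s) := by
  have hcol : ∀ k, x₀ ≤ k → IsShellable (staircase x₀ y₀ t k y₀) →
      ∀ s, y₀ ≤ s → s ≤ t → IsShellable (staircase x₀ y₀ t k s) := by
    intro k hk h0 s hs
    induction s, hs using Int.leInduction with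
    | base => exact fun _ => h0
    | succ s hs ih =>
      intro hst
      obtain ⟨S, hS⟩ := isShellingStep_staircase hk hs (by omega : s < t)
      convert (ih (by omega)).add hS using 1
      funext i j
      simp only [staircase, addCell, eq_iff_iff]
      omega
  refine hcol k hk ?_ s hs hst
  clear hst hs
  induction k, hk using Int.leInduction with
  | base =>
    convert IsShellable.empty using 1
    funext i j
    simp only [staircase, eq_iff_iff, iff_false]
    omega
  | succ k hk ih =>
    by_cases hyt : y₀ ≤ t
    · convert hcol k hk ih t hyt le_rfl using 1
      funext i j
      simp only [staircase, eq_iff_iff]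
      omega
    · convert IsShellable.empty using 1
      funext i j
      simp only [staircase, eq_iff_iff, iff_false]
      omega

/-- The interior triangles of the region `R` none of whose proper faces is interior. -/
def minimalInteriorTriangles (R : ℤ → ℤ → Prop) : Set (Finset (ℤ ⊕ ℤ)) :=
  {T | T.card = 3 ∧ InInterior R T ∧ ∀ G ⊂ T, ¬ InInterior R G}

/-- Every triangle all of whose proper faces lie in cells of `R` lies in a cell of `R`. -/
def HasNoMissingTriangle (R : ℤ → ℤ → Prop) : Prop :=
  ∀ T : Finset (ℤ ⊕ ℤ), T.card = 3 → (∀ G ⊂ T, InRegion R G) → InRegion R T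

section

variable {K : Set (Finset (ℤ ⊕ ℤ))} {w w' : ℤ ⊕ ℤ} {R : ℤ → ℤ → Prop}

/-- The link of w' is R ∪ w * ∂R. A missing tetrahedron through w' would need a triangle in K
outside this link whose edges lie in it: without w it would be a missing triangle of R, and with w
it would be an interior face, which has been deleted. Away from w', a missing tetrahedron is either
an old one, which survives because it avoids w, or a deleted face all of whose proper subsets
remain. -/
theorem IsConeIn.missingTetra_reconed (hK : IsConeIn K w R) (hw' : ∀ F ∈ K, w' ∉ F)
    (hR : HasNoMissingTriangle R) (hm : ∀ F ∈ missingTetra K, w ∉ F) :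
    missingTetra (reconed K w w' R) =
      missingTetra K ∪ insert w '' minimalInteriorTriangles R := by
  have hwF : ∀ T, InRegion R T → w ∉ T := by
    rintro T ⟨i, j, hij, hT⟩ hw
    exact hK.notMem i j hij (hT hw)
  ext F
  constructor
  · rintro ⟨h1, h2, h3⟩
    by_cases hwF' : w' ∈ F
    · exfalso
      have hsub : ∀ G ⊂ F.erase w', InRegion R (G.erase w) := by
        intro G hG
        have hG' : w' ∉ G := fun hh => by simpa using hG.1 hh
        have hGF : insert w' G ⊂ F := by
          rw [← Finset.insert_erase hwF']
          refine Finset.ssubset_iff_subset_ne.2 ⟨Finset.insert_subset_insert _ hG.1, fun hh => ?_⟩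
          refine hG.ne ?_
          rw [← Finset.erase_insert hG', hh, Finset.erase_insert (by simp)]
        rcases h3 _ hGF with ⟨h4, -⟩ | ⟨-, h4, -⟩
        · simp at h4
        · rwa [Finset.erase_insert hG'] at h4
      have hT : ¬ InConeInterior w R (F.erase w') := by
        rcases h3 _ (Finset.erase_ssubset hwF') with ⟨-, -, h4⟩ | ⟨h4, -⟩
        · exact h4
        · simp at h4
      refine h2 (Or.inr ⟨hwF', ?_, hT⟩)
      by_cases hwT : w ∈ F.erase w'
      · have := hsub _ (Finset.erase_ssubset hwT)
        rwa [Finset.erase_idem] at this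
      · rw [Finset.erase_eq_of_notMem hwT]
        refine hR _ (by rw [Finset.card_erase_of_mem hwF', h1]) fun G hG => ?_
        have := hsub G hG
        rwa [Finset.erase_eq_of_notMem fun hh => hwT (hG.1 hh)] at this
    · have hsub : ∀ G ⊂ F, G ∈ K ∧ ¬ InConeInterior w R G := by
        intro G hG
        rcases h3 G hG with ⟨-, h4⟩ | ⟨h4, -⟩
        · exact h4
        · exact absurd (hG.1 h4) hwF'
      by_cases hFK : F ∈ K
      · right
        have hi : InConeInterior w R F := by
          by_contra hn
          exact h2 (Or.inl ⟨hwF', hFK, hn⟩)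
        refine ⟨F.erase w, ⟨?_, hi.2, fun G hG hGi => ?_⟩, Finset.insert_erase hi.1⟩
        · rw [Finset.card_erase_of_mem hi.1, h1]
        · have hwG := hwF G hGi.inRegion
          refine (hsub (insert w G) ?_).2 ⟨by simp, by rwa [Finset.erase_insert hwG]⟩
          rw [← Finset.insert_erase hi.1]
          refine Finset.ssubset_iff_subset_ne.2 ⟨Finset.insert_subset_insert _ hG.1, fun hh => ?_⟩
          refine hG.ne ?_
          rw [← Finset.erase_insert hwG, hh, Finset.erase_insert (by simp)]
      · exact Or.inl ⟨h1, hFK, fun G hG => (hsub G hG).1⟩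
  · rintro (h | ⟨T, ⟨h1, h2, h3⟩, rfl⟩)
    · have hwF := hm F h
      obtain ⟨h1, h2, h3⟩ := h
      have hw'F : w' ∉ F := by
        intro hh
        refine hw' {w'} (h3 {w'} ?_) (by simp)
        refine Finset.ssubset_iff_subset_ne.2 ⟨by simpa using hh, fun h => ?_⟩
        rw [← h] at h1
        simp at h1
      refine ⟨h1, ?_, fun G hG => Or.inl ⟨fun hh => hw'F (hG.1 hh), h3 G hG,
        fun hh => hwF (hG.1 hh.1)⟩⟩
      rintro (⟨-, h, -⟩ | ⟨h, -⟩)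
      exacts [h2 h, hw'F h]
    · have hwT := hwF T h2.inRegion
      obtain ⟨i, j, hij, hT⟩ := h2.inRegion
      have hTK : insert w T ∈ K :=
        hK.lower (Finset.insert_subset_insert w hT) (hK.cell_mem i j hij)
      have hw'T := hw' _ hTK
      refine ⟨by rw [Finset.card_insert_of_notMem hwT, h1], ?_, fun G hG => Or.inl ⟨fun hh =>
        hw'T (hG.1 hh), hK.lower hG.1 hTK, ?_⟩⟩
      · rintro (⟨-, -, h⟩ | ⟨h, -⟩)
        · exact h ⟨by simp, by rwa [Finset.erase_insert hwT]⟩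
        · exact hw'T h
      · rintro ⟨hwG, hGi⟩
        refine h3 _ (Finset.ssubset_iff_subset_ne.2 ⟨?_, fun hh => ?_⟩) hGi
        · rw [← Finset.erase_insert hwT]
          exact Finset.erase_subset_erase w hG.1
        · refine hG.ne ?_
          rw [← hh, Finset.insert_erase hwG]

end

/-- The region `R'` arises from `R` by adding cells along a boundary line of `R`, the new line
having coordinate `w`. -/
structure IsExtension (R : ℤ → ℤ → Prop) (w : ℤ ⊕ ℤ) (R' : ℤ → ℤ → Prop) : Prop where
  notMem : ¬ InRegion R {w}
  mono : ∀ i j, R i j → R' i j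
  mem : InRegion R' {w}
  new : ∀ i j, R' i j → ¬ R i j → w ∈ gridCell i j ∧ InRegion R ((gridCell i j).erase w)
  star : ∀ F T, InInterior R' F → w ∈ F → F.erase w ⊆ T → w ∉ T → InRegion R T →
    ¬ InInterior R T → InRegion R' (insert w T)

/-- A `2`-neighborly sphere with `n` vertices and `m` missing tetrahedra, in which the vertex `w`
belongs to no missing tetrahedron and is the apex of a cone over the region `R` that contains all
vertices. -/
structure IsConeSphere (K : Set (Finset (ℤ ⊕ ℤ))) (X : Finset (ℤ ⊕ ℤ)) (w : ℤ ⊕ ℤ)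
    (R : ℤ → ℤ → Prop) (n m : ℕ) : Prop where
  cone : IsConeIn K w R
  subset : ∀ F ∈ K, F ⊆ X
  card : X.card = n
  apex_mem : w ∈ X
  spanning : ∀ v ∈ X, v ≠ w → InRegion R {v}
  edge : ∀ F ⊆ X, F.card = 2 → F ∈ K
  sphere : IsPLSphereFamily K 4
  missing : (missingTetra K).ncard = m
  apex_notMem : ∀ F ∈ missingTetra K, w ∉ F

/-- Cone spheres over the region `R` exist for every choice of the name of the apex. -/
def HasConeSphere (R : ℤ → ℤ → Prop) (n m : ℕ) : Prop :=
  ∀ w, ¬ InRegion R {w} → ∃ K X, IsConeSphere K X w R n m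

/-- The old apex w becomes a grid vertex of R', and w' is the new apex. Cells of R stay in the link
of w', while a new cell is w joined to a triangle of R that is on the boundary because the new cell
itself is not in R. -/
theorem IsConeSphere.reconed {K : Set (Finset (ℤ ⊕ ℤ))} {X : Finset (ℤ ⊕ ℤ)} {w w' : ℤ ⊕ ℤ}
    {R R' : ℤ → ℤ → Prop} {n m : ℕ} (h : IsConeSphere K X w R n m) (hS : IsShellable R)
    (hR : HasNoMissingTriangle R) (hext : IsExtension R w R') (hw' : ¬ InRegion R' {w'}) :
    IsConeSphere (reconed K w w' R) (insert w' X) w' R' (n + 1)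
      (m + (minimalInteriorTriangles R).ncard) := by
  have hww' : w' ≠ w := by rintro rfl; exact hw' hext.mem
  have hw'X : w' ∉ X := fun hh =>
    hw' ((h.spanning w' hh hww').mono hext.mono subset_rfl)
  have hw'K : ∀ F ∈ K, w' ∉ F := fun F hF hh => hw'X (h.subset F hF hh)
  have hw'cell : ∀ i j, R' i j → w' ∉ gridCell i j := fun i j hij hh =>
    hw' ⟨i, j, hij, by simpa using hh⟩
  have hwR : ∀ T, InRegion R T → w ∉ T := by
    rintro T ⟨i, j, hij, hT⟩ hw
    exact h.cone.notMem i j hij (hT hw)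
  obtain ⟨hlow, hPL⟩ := h.cone.reconed_of_isShellable hw'K hS (fun _ _ hij => hij) h.sphere
  have hmiss := h.cone.missingTetra_reconed hw'K hR h.apex_notMem
  refine ⟨⟨hlow, hw'cell, fun i j hij => ?_, fun F G hF hFG hw'G hG => ?_⟩, ?_, ?_, by simp, ?_, ?_,
    hPL, ?_, ?_⟩
  · refine Or.inr ⟨by simp, ?_⟩
    rw [Finset.erase_insert (hw'cell i j hij)]
    by_cases hRij : R i j
    · have hw := h.cone.notMem i j hRij
      exact ⟨⟨i, j, hRij, Finset.erase_subset _ _⟩, fun hh => hw hh.1⟩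
    · exact ⟨(hext.new i j hij hRij).2, fun hh => hRij (hh.2.cells i j (Finset.erase_subset _ _))⟩
  · obtain ⟨h1, -⟩ | ⟨-, h1, h2⟩ := hG
    · exact absurd hw'G h1
    · have hw'F : w' ∉ F := by
        obtain ⟨i, j, hij, hFij⟩ := hF.inRegion
        exact fun hh => hw'cell i j hij (hFij hh)
      have hFG' : F ⊆ G.erase w' := Finset.subset_erase.2 ⟨hFG, hw'F⟩
      by_cases hwG : w ∈ G.erase w'
      · have hni : ¬ InInterior R ((G.erase w').erase w) := fun hh => h2 ⟨hwG, hh⟩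
        rw [← Finset.insert_erase hwG]
        by_cases hwF : w ∈ F
        · exact hext.star F _ hF hwF (Finset.erase_subset_erase w hFG') (by simp) h1 hni
        · have hFT : F ⊆ (G.erase w').erase w := Finset.subset_erase.2 ⟨hFG', hwF⟩
          -- The rest of G after removing w and w' is a boundary face of R, so it lies in a cell
          -- outside R. That cell contains the R'-interior face F, hence is a new cell of R' and
          -- contains w.
          obtain ⟨i, j, hsub, hRij⟩ : ∃ i j, (G.erase w').erase w ⊆ gridCell i j ∧ ¬ R i j := by
            by_contra! hcon
            obtain ⟨i, j, -, hij⟩ := h1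
            exact hni ⟨hF.left.imp fun _ hi => hFT hi, hF.right.imp fun _ hi => hFT hi,
              ⟨i, j, hij⟩, hcon⟩
          have hR'ij := hF.cells i j (hFT.trans hsub)
          exact ⟨i, j, hR'ij, Finset.insert_subset (hext.new i j hR'ij hRij).1 hsub⟩
      · rw [Finset.erase_eq_of_notMem hwG] at h1
        exact h1.mono hext.mono subset_rfl
  · rintro F (⟨-, hF, -⟩ | ⟨-, ⟨i, j, hij, hF⟩, -⟩)
    · exact (h.subset F hF).trans (Finset.subset_insert _ _)
    · rw [← Finset.subset_insert_iff] at hF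
      rw [Finset.subset_insert_iff]
      exact hF.trans (h.subset _ (h.cone.cell_mem i j hij))
  · rw [Finset.card_insert_of_notMem hw'X, h.card]
  · intro v hv hvw'
    have hvX : v ∈ X := (Finset.mem_insert.1 hv).resolve_left hvw'
    by_cases hvw : v = w
    · exact hvw ▸ hext.mem
    · exact (h.spanning v hvX hvw).mono hext.mono subset_rfl
  · intro F hF hF2
    have hcard : ∀ A, InInterior R A → 2 ≤ A.card := by
      intro A hA
      obtain ⟨i, hi⟩ := hA.left
      obtain ⟨j, hj⟩ := hA.right
      exact Finset.one_lt_card.2 ⟨_, hi, _, hj, by simp⟩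
    -- An interior face of R has a vertex on each path, so together with w it has at least three
    -- vertices: no edge is deleted.
    have hni : ∀ G : Finset (ℤ ⊕ ℤ), G.card ≤ 2 → ¬ InConeInterior w R G := by
      intro G hG hh
      have h1 := hcard _ hh.2
      have h2 := Finset.card_erase_lt_of_mem hh.1
      omega
    by_cases hw'F : w' ∈ F
    · have hc := Finset.card_erase_of_mem hw'F
      refine Or.inr ⟨hw'F, ?_, hni _ (by omega)⟩
      obtain ⟨v, hv⟩ := Finset.card_eq_one.1 (by omega : (F.erase w').card = 1)
      have hvF : v ∈ F.erase w' := by rw [hv]; simp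
      rw [hv]
      by_cases hvw : v = w
      · rw [hvw, Finset.erase_singleton]
        obtain ⟨i, j, hij, -⟩ := hext.mem
        by_cases hRij : R i j
        · exact ⟨i, j, hRij, by simp⟩
        · exact (hext.new i j hij hRij).2.mono (fun _ _ hh => hh) (by simp)
      · have hvX : v ∈ X := by
          have := hF (Finset.mem_of_mem_erase hvF)
          exact (Finset.mem_insert.1 this).resolve_left (Finset.ne_of_mem_erase hvF)
        exact (h.spanning v hvX hvw).mono (fun _ _ hh => hh) (Finset.erase_subset _ _)
    · refine Or.inl ⟨hw'F, h.edge F ?_ hF2, hni F hF2.le⟩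
      intro v hv
      exact (Finset.mem_insert.1 (hF hv)).resolve_left fun hh => hw'F (hh ▸ hv)
  · have hfin : (missingTetra K).Finite := by
      refine (X.powerset.finite_toSet).subset fun F hF => ?_
      rw [Finset.mem_coe, Finset.mem_powerset]
      intro v hv
      refine h.subset {v} (hF.2.2 {v} ?_) (by simp)
      refine Finset.ssubset_iff_subset_ne.2 ⟨by simpa using hv, fun hh => ?_⟩
      have := hF.1
      rw [← hh] at this
      simp at this
    have hfin' : (minimalInteriorTriangles R).Finite := by
      refine (X.powerset.finite_toSet).subset fun T hT => ?_
      rw [Finset.mem_coe, Finset.mem_powerset]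
      obtain ⟨i, j, hij, hTij⟩ := hT.2.1.inRegion
      exact (hTij.trans (Finset.subset_insert _ _)).trans (h.subset _ (h.cone.cell_mem i j hij))
    rw [hmiss, Set.ncard_union_eq ?_ hfin (hfin'.image _), h.missing,
      Set.InjOn.ncard_image]
    · intro T hT T' hT' hTT'
      have h1 := hwR T hT.2.1.inRegion
      have h2 := hwR T' hT'.2.1.inRegion
      rw [← Finset.erase_insert h1, hTT', Finset.erase_insert h2]
    · rw [Set.disjoint_left]
      rintro F hF ⟨T, -, rfl⟩
      exact h.apex_notMem _ hF (by simp)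
  · intro F hF
    rw [hmiss] at hF
    rcases hF with hF | ⟨T, hT, rfl⟩
    · intro hh
      refine hw'K {w'} (hF.2.2 {w'} ?_) (by simp)
      refine Finset.ssubset_iff_subset_ne.2 ⟨by simpa using hh, fun hh => ?_⟩
      have := hF.1
      rw [← hh] at this
      simp at this
    · obtain ⟨i, j, hij, hTij⟩ := hT.2.1.inRegion
      intro hh
      rcases Finset.mem_insert.1 hh with hh | hh
      · exact hww' hh
      · exact hw'cell i j (hext.mono i j hij) (hTij hh)

theorem HasConeSphere.extend {R R' : ℤ → ℤ → Prop} {n m : ℕ} {w : ℤ ⊕ ℤ}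
    (h : HasConeSphere R n m) (hS : IsShellable R) (hR : HasNoMissingTriangle R)
    (hext : IsExtension R w R') :
    HasConeSphere R' (n + 1) (m + (minimalInteriorTriangles R).ncard) := by
  intro w' hw'
  obtain ⟨K, X, hK⟩ := h w hext.notMem
  exact ⟨_, _, hK.reconed hS hR hext hw'⟩

end Step

/-! ### Growing a staircase by a row or a column; missing triangles of staircases. -/

section Regions

open Sum

theorem not_inRegion_inl {R : ℤ → ℤ → Prop} {x : ℤ} :
    ¬ InRegion R {inl x} ↔ ∀ j, ¬ R x j ∧ ¬ R (x - 1) j := by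
  simp only [InRegion, Finset.singleton_subset_iff, inl_mem_gridCell, not_exists, not_and]
  constructor
  · intro h j
    exact ⟨fun hh => h _ j hh (Or.inl rfl), fun hh => h _ j hh (Or.inr (by omega))⟩
  · rintro h i j hij (rfl | rfl)
    · exact (h j).1 hij
    · refine (h j).2 ?_
      rwa [add_sub_cancel_right]

theorem not_inRegion_inr {R : ℤ → ℤ → Prop} {y : ℤ} :
    ¬ InRegion R {inr y} ↔ ∀ i, ¬ R i y ∧ ¬ R i (y - 1) := by
  simp only [InRegion, Finset.singleton_subset_iff, inr_mem_gridCell, not_exists, not_and]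
  constructor
  · intro h i
    exact ⟨fun hh => h i _ hh (Or.inl rfl), fun hh => h i _ hh (Or.inr (by omega))⟩
  · rintro h i j hij (rfl | rfl)
    · exact (h i).1 hij
    · refine (h i).2 ?_
      rwa [add_sub_cancel_right]

/-- Adding cells in the row between `y'` and the new height `y`: here `r` is the index of the new
row, `r'` that of the row on the other side of the line of height `y'`, and `r''` that of the row
beyond the new line. -/
theorem isExtension_row {R R' : ℤ → ℤ → Prop} {y y' r r' r'' : ℤ}
    (hy : (y' = y - 1 ∧ r = y - 1 ∧ r' = y - 2 ∧ r'' = y) ∨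
      (y' = y + 1 ∧ r = y ∧ r' = y + 1 ∧ r'' = y - 1))
    (hR : ∀ i, ¬ R i y ∧ ¬ R i (y - 1)) (hmono : ∀ i j, R i j → R' i j)
    (hne : ∃ i, R' i r) (hnew : ∀ i j, R' i j → ¬ R i j → j = r)
    (hbelow : ∀ i, R' i r → R i r') : IsExtension R (inr y) R' := by
  have hcell : ∀ i, (gridCell i r).erase (inr y) ⊆ gridCell i r' := by
    rintro i (u | u) hu <;> simp at hu ⊢ <;> omega
  refine ⟨not_inRegion_inr.2 hR, hmono, ?_, fun i j hij hn => ?_, ?_⟩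
  · obtain ⟨i, hi⟩ := hne
    exact ⟨i, r, hi, by simp; omega⟩
  · obtain rfl := hnew i j hij hn
    exact ⟨by simp; omega, i, r', hbelow i hij, hcell i⟩
  · intro F T hF hyF hFT hyT hT hni
    have hrow : ∀ i j, R' i j → j = y ∨ j = y - 1 → j = r := fun i j h1 h2 =>
      hnew i j h1 (by rcases h2 with rfl | rfl; exacts [(hR i).1, (hR i).2])
    have hF' : F ⊆ insert (inr y) T := Finset.subset_insert_iff.2 hFT
    obtain ⟨x, hx⟩ := hF.left
    have hxT : inl x ∈ T := hFT (by simp [hx])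
    obtain ⟨a, b, hab, hFab⟩ := hF.inRegion
    have hby := inr_mem_gridCell.1 (hFab hyF)
    obtain rfl : b = r := hrow a b hab (by omega)
    -- Without y', the face F would also lie in row r'' beyond the new line, where R' has no cells.
    have hy'F : inr y' ∈ F := by
      by_contra hcon
      have h1 := hF.cells a r'' (by
        rintro (u | u) hu
        · simpa using hFab hu
        · have h1 := inr_mem_gridCell.1 (hFab hu)
          have h2 : u ≠ y' := by rintro rfl; exact hcon hu
          simp; omega)
      have := hrow a r'' h1 (by omega)
      omega
    have hy'T : inr y' ∈ T := hFT (by simp [hy'F]; omega)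
    obtain ⟨i, j, hij, hTij⟩ := hT
    have hj : j = r' := by
      have h1 := inr_mem_gridCell.1 (hTij hy'T)
      have h2 := hR i
      have h3 : j ≠ y := by rintro rfl; exact h2.1 hij
      have h4 : j ≠ y - 1 := by rintro rfl; exact h2.2 hij
      omega
    subst hj
    -- If T reaches beyond the line y', all cells containing it are in row r'. Being non-interior, T
    -- lies in such a cell outside R; but the cell of the new row in the same column contains F,
    -- hence belongs to R', and so the cell next to it belongs to R. Otherwise T together with the
    -- new vertex fits into a cell of the new row.
    by_cases hfar : ∃ u, inr u ∈ T ∧ u ≠ y'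
    · exfalso
      obtain ⟨u, hu, huy⟩ := hfar
      obtain ⟨i', j', hsub, hn⟩ : ∃ i' j', T ⊆ gridCell i' j' ∧ ¬ R i' j' := by
        by_contra! hcon
        exact hni ⟨⟨x, hxT⟩, ⟨y', hy'T⟩, ⟨i, j, hTij⟩, hcon⟩
      have h1 := inr_mem_gridCell.1 (hTij hu)
      have h2 := inr_mem_gridCell.1 (hsub hu)
      have h3 := inr_mem_gridCell.1 (hsub hy'T)
      obtain rfl : j' = j := by omega
      refine hn (hbelow i' (hF.cells i' b ?_))
      rintro (v | v) hv
      · have : inl v ∈ T := hFT (by simp [hv])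
        simpa using hsub this
      · simpa using hFab hv
    · have hsub : insert (inr y) T ⊆ gridCell i b := by
        rintro (v | v) hv
        · have : inl v ∈ T := by simpa using hv
          simpa using hTij this
        · have : v = y ∨ v = y' := by
            by_contra hcon
            have hvT : inr v ∈ T := by
              rcases Finset.mem_insert.1 hv with h | h
              · simp at h; omega
              · exact h
            exact hfar ⟨v, hvT, by omega⟩
          simp; omega
      exact ⟨i, b, hF.cells i b (hF'.trans hsub), hsub⟩

/-- Adding cells in the column between `x'` and the new abscissa `x`. -/
theorem isExtension_column {R R' : ℤ → ℤ → Prop} {x x' c c' c'' : ℤ}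
    (hx : (x' = x - 1 ∧ c = x - 1 ∧ c' = x - 2 ∧ c'' = x) ∨
      (x' = x + 1 ∧ c = x ∧ c' = x + 1 ∧ c'' = x - 1))
    (hR : ∀ j, ¬ R x j ∧ ¬ R (x - 1) j) (hmono : ∀ i j, R i j → R' i j)
    (hne : ∃ j, R' c j) (hnew : ∀ i j, R' i j → ¬ R i j → i = c)
    (hbelow : ∀ j, R' c j → R c' j) : IsExtension R (inl x) R' := by
  have hcell : ∀ j, (gridCell c j).erase (inl x) ⊆ gridCell c' j := by
    rintro j (u | u) hu <;> simp at hu ⊢ <;> omega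
  refine ⟨not_inRegion_inl.2 hR, hmono, ?_, fun i j hij hn => ?_, ?_⟩
  · obtain ⟨j, hj⟩ := hne
    exact ⟨c, j, hj, by simp; omega⟩
  · obtain rfl := hnew i j hij hn
    exact ⟨by simp; omega, c', j, hbelow j hij, hcell j⟩
  · intro F T hF hxF hFT hxT hT hni
    have hcol : ∀ i j, R' i j → i = x ∨ i = x - 1 → i = c := fun i j h1 h2 =>
      hnew i j h1 (by rcases h2 with rfl | rfl; exacts [(hR j).1, (hR j).2])
    have hF' : F ⊆ insert (inl x) T := Finset.subset_insert_iff.2 hFT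
    obtain ⟨y, hy⟩ := hF.right
    have hyT : inr y ∈ T := hFT (by simp [hy])
    obtain ⟨a, b, hab, hFab⟩ := hF.inRegion
    have hax := inl_mem_gridCell.1 (hFab hxF)
    obtain rfl : a = c := hcol a b hab (by omega)
    have hx'F : inl x' ∈ F := by
      by_contra hcon
      have h1 := hF.cells c'' b (by
        rintro (u | u) hu
        · have h1 := inl_mem_gridCell.1 (hFab hu)
          have h2 : u ≠ x' := by rintro rfl; exact hcon hu
          simp; omega
        · simpa using hFab hu)
      have := hcol c'' b h1 (by omega)
      omega
    have hx'T : inl x' ∈ T := hFT (by simp [hx'F]; omega)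
    obtain ⟨i, j, hij, hTij⟩ := hT
    have hi : i = c' := by
      have h1 := inl_mem_gridCell.1 (hTij hx'T)
      have h2 := hR j
      have h3 : i ≠ x := by rintro rfl; exact h2.1 hij
      have h4 : i ≠ x - 1 := by rintro rfl; exact h2.2 hij
      omega
    subst hi
    by_cases hfar : ∃ u, inl u ∈ T ∧ u ≠ x'
    · exfalso
      obtain ⟨u, hu, hux⟩ := hfar
      obtain ⟨i', j', hsub, hn⟩ : ∃ i' j', T ⊆ gridCell i' j' ∧ ¬ R i' j' := by
        by_contra! hcon
        exact hni ⟨⟨x', hx'T⟩, ⟨y, hyT⟩, ⟨i, j, hTij⟩, hcon⟩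
      have h1 := inl_mem_gridCell.1 (hTij hu)
      have h2 := inl_mem_gridCell.1 (hsub hu)
      have h3 := inl_mem_gridCell.1 (hsub hx'T)
      obtain rfl : i' = i := by omega
      refine hn (hbelow j' (hF.cells a j' ?_))
      rintro (v | v) hv
      · simpa using hFab hv
      · have : inr v ∈ T := hFT (by simp [hv])
        simpa using hsub this
    · have hsub : insert (inl x) T ⊆ gridCell a j := by
        rintro (v | v) hv
        · have : v = x ∨ v = x' := by
            by_contra hcon
            have hvT : inl v ∈ T := by
              rcases Finset.mem_insert.1 hv with h | h
              · simp at h; omega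
              · exact h
            exact hfar ⟨v, hvT, by omega⟩
          simp; omega
        · have : inr v ∈ T := by simpa using hv
          simpa using hTij this
      exact ⟨a, j, hF.cells a j (hF'.trans hsub), hsub⟩

theorem isExtension_staircase_top {x₀ y₀ t s : ℤ} (hx : x₀ ≤ 0) (ht : y₀ < t) (hs : s ≤ t) :
    IsExtension (staircase x₀ y₀ t 1 s) (inr (t + 1)) (staircase x₀ y₀ (t + 1) 1 s) := by
  refine isExtension_row (y' := t) (r := t) (r' := t - 1) (r'' := t + 1)
    (Or.inl ⟨by omega, by omega, by omega, rfl⟩) ?_ ?_ ⟨0, ?_⟩ ?_ ?_ <;>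
  simp only [staircase] <;> intros <;> omega

theorem isExtension_staircase_bottom {x₀ y₀ t s : ℤ} (hx : x₀ ≤ 0) (ht : y₀ < t) (hs : y₀ < s) :
    IsExtension (staircase x₀ y₀ t 1 s) (inr (y₀ - 1)) (staircase x₀ (y₀ - 1) t 1 s) := by
  refine isExtension_row (y' := y₀) (r := y₀ - 1) (r' := y₀) (r'' := y₀ - 2)
    (Or.inr ⟨by omega, by omega, by omega, by omega⟩) ?_ ?_ ⟨0, ?_⟩ ?_ ?_ <;>
  simp only [staircase] <;> intros <;> omega

theorem isExtension_staircase_left {x₀ y₀ t s : ℤ} (hx : x₀ ≤ 0) (ht : y₀ < t) :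
    IsExtension (staircase x₀ y₀ t 1 s) (inl (x₀ - 1)) (staircase (x₀ - 1) y₀ t 1 s) := by
  refine isExtension_column (x' := x₀) (c := x₀ - 1) (c' := x₀) (c'' := x₀ - 2)
    (Or.inr ⟨by omega, by omega, by omega, by omega⟩) ?_ ?_ ⟨y₀, ?_⟩ ?_ ?_ <;>
  simp only [staircase] <;> intros <;> omega

theorem isExtension_staircase_right {x₀ y₀ t s : ℤ} (hx : x₀ ≤ 0) (hs : y₀ < s) (hst : s ≤ t) :
    IsExtension (staircase x₀ y₀ t 1 y₀) (inl 2) (staircase x₀ y₀ t 1 s) := by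
  refine isExtension_column (x' := 1) (c := 1) (c' := 0) (c'' := 2)
    (Or.inl ⟨by omega, by omega, by omega, by omega⟩) ?_ ?_ ⟨y₀, ?_⟩ ?_ ?_ <;>
  simp only [staircase, true_and] <;> intros <;> omega

theorem exists_gridCell_inl_inl_inr {x₀ y₀ t s x x' y i j i' j' i'' j'' : ℤ} (hs : s ≤ t)
    (hne : x ≠ x') (h : staircase x₀ y₀ t 1 s i j) (h' : staircase x₀ y₀ t 1 s i' j')
    (h'' : staircase x₀ y₀ t 1 s i'' j'') (g1 : inl x ∈ gridCell i j)
    (g2 : inl x' ∈ gridCell i j) (g3 : inl x ∈ gridCell i' j') (g4 : inr y ∈ gridCell i' j')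
    (g5 : inl x' ∈ gridCell i'' j'') (g6 : inr y ∈ gridCell i'' j'') :
    ∃ i j, staircase x₀ y₀ t 1 s i j ∧ inl x ∈ gridCell i j ∧ inl x' ∈ gridCell i j ∧
      inr y ∈ gridCell i j := by
  simp only [inl_mem_gridCell, inr_mem_gridCell] at *
  by_cases hR : staircase x₀ y₀ t 1 s i y
  · exact ⟨i, y, hR, by omega, by omega, by omega⟩
  · refine ⟨i, y - 1, ?_, by omega, by omega, by omega⟩
    have hi : i = x ∨ i = x' := by omega
    simp only [staircase] at *
    rcases h with h | h <;> rcases h' with h' | h' <;> rcases h'' with h'' | h'' <;> omega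

theorem exists_gridCell_inr_inr_inl {x₀ y₀ t s x y y' i j i' j' i'' j'' : ℤ} (hs : s ≤ t)
    (hne : y ≠ y') (h : staircase x₀ y₀ t 1 s i j) (h' : staircase x₀ y₀ t 1 s i' j')
    (h'' : staircase x₀ y₀ t 1 s i'' j'') (g1 : inr y ∈ gridCell i j)
    (g2 : inr y' ∈ gridCell i j) (g3 : inr y ∈ gridCell i' j') (g4 : inl x ∈ gridCell i' j')
    (g5 : inr y' ∈ gridCell i'' j'') (g6 : inl x ∈ gridCell i'' j'') :
    ∃ i j, staircase x₀ y₀ t 1 s i j ∧ inr y ∈ gridCell i j ∧ inr y' ∈ gridCell i j ∧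
      inl x ∈ gridCell i j := by
  simp only [inl_mem_gridCell, inr_mem_gridCell] at *
  by_cases hR : staircase x₀ y₀ t 1 s x j
  · exact ⟨x, j, hR, by omega, by omega, by omega⟩
  · refine ⟨x - 1, j, ?_, by omega, by omega, by omega⟩
    simp only [staircase] at *
    rcases h with h | h <;> rcases h' with h' | h' <;> rcases h'' with h'' | h'' <;> omega

/-- A path has no triangles, so exactly two of three pairwise adjacent vertices lie on one path.
They fix a column or a row, and the staircase shape places the third vertex in a cell of it. -/
theorem hasNoMissingTriangle_staircase {x₀ y₀ t s : ℤ} (hs : s ≤ t) :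
    HasNoMissingTriangle (staircase x₀ y₀ t 1 s) := by
  intro T hT hG
  obtain ⟨a, b, c, hab, hac, hbc, rfl⟩ := Finset.card_eq_three.1 hT
  have hpair : ∀ u v, {u, v} ⊆ ({a, b, c} : Finset (ℤ ⊕ ℤ)) →
      ∃ i j, staircase x₀ y₀ t 1 s i j ∧ u ∈ gridCell i j ∧ v ∈ gridCell i j := by
    intro u v huv
    obtain ⟨i, j, hij, hsub⟩ := hG {u, v} (Finset.ssubset_iff_subset_ne.2 ⟨huv, fun h => by
      rw [← h] at hT
      have := Finset.card_le_two (a := u) (b := v)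
      omega⟩)
    exact ⟨i, j, hij, hsub (by simp), hsub (by simp)⟩
  obtain ⟨i₁, j₁, h1, ha1, hb1⟩ := hpair a b (by intro v; simp; tauto)
  obtain ⟨i₂, j₂, h2, ha2, hc2⟩ := hpair a c (by intro v; simp; tauto)
  obtain ⟨i₃, j₃, h3, hb3, hc3⟩ := hpair b c (by intro v; simp; tauto)
  have hfin : ∀ i j, staircase x₀ y₀ t 1 s i j → a ∈ gridCell i j → b ∈ gridCell i j →
      c ∈ gridCell i j → InRegion (staircase x₀ y₀ t 1 s) {a, b, c} := fun i j hij ha hb hc =>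
    ⟨i, j, hij, by simp [Finset.insert_subset_iff, ha, hb, hc]⟩
  clear hpair hG hT
  rcases a with a | a <;> rcases b with b | b <;> rcases c with c | c
  · simp only [inl_mem_gridCell, ne_eq, Sum.inl.injEq] at *
    omega
  · obtain ⟨i, j, h, g1, g2, g3⟩ := exists_gridCell_inl_inl_inr hs (by simpa using hab) h1 h2 h3 ha1 hb1
      ha2 hc2 hb3 hc3
    exact hfin i j h g1 g2 g3
  · obtain ⟨i, j, h, g1, g2, g3⟩ := exists_gridCell_inl_inl_inr hs (by simpa using hac) h2 h1 h3 ha2 hc2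
      ha1 hb1 hc3 hb3
    exact hfin i j h g1 g3 g2
  · obtain ⟨i, j, h, g1, g2, g3⟩ := exists_gridCell_inr_inr_inl hs (by simpa using hbc) h3 h1 h2 hb3 hc3
      hb1 ha1 hc2 ha2
    exact hfin i j h g3 g1 g2
  · obtain ⟨i, j, h, g1, g2, g3⟩ := exists_gridCell_inl_inl_inr hs (by simpa using hbc) h3 h1 h2 hb3 hc3
      hb1 ha1 hc2 ha2
    exact hfin i j h g3 g1 g2
  · obtain ⟨i, j, h, g1, g2, g3⟩ := exists_gridCell_inr_inr_inl hs (by simpa using hac) h2 h1 h3 ha2 hc2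
      ha1 hb1 hc3 hb3
    exact hfin i j h g1 g3 g2
  · obtain ⟨i, j, h, g1, g2, g3⟩ := exists_gridCell_inr_inr_inl hs (by simpa using hab) h1 h2 h3 ha1 hb1
      ha2 hc2 hb3 hc3
    exact hfin i j h g1 g2 g3
  · simp only [inr_mem_gridCell, ne_eq, Sum.inr.injEq] at *
    omega

end Regions

/-! ### Interior triangles without interior edges. -/

section Counting

open Sum

theorem inInterior_horizontal {R : ℤ → ℤ → Prop} {a b : ℤ} :
    InInterior R {inl a, inl (a + 1), inr b} ↔ R a b ∧ R a (b - 1) := by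
  constructor
  · intro h
    constructor <;> refine h.cells _ _ ?_ <;> simp [Finset.insert_subset_iff]
  · rintro ⟨h1, h2⟩
    refine ⟨⟨a, by simp⟩, ⟨b, by simp⟩, ⟨a, b, by simp [Finset.insert_subset_iff]⟩, ?_⟩
    intro i j hij
    simp only [Finset.insert_subset_iff, Finset.singleton_subset_iff, inl_mem_gridCell,
      inr_mem_gridCell] at hij
    obtain rfl : i = a := by omega
    obtain rfl | rfl : j = b ∨ j = b - 1 := by omega
    exacts [h1, h2]

theorem inInterior_vertical {R : ℤ → ℤ → Prop} {a b : ℤ} :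
    InInterior R {inl a, inr b, inr (b + 1)} ↔ R a b ∧ R (a - 1) b := by
  constructor
  · intro h
    constructor <;> refine h.cells _ _ ?_ <;> simp [Finset.insert_subset_iff]
  · rintro ⟨h1, h2⟩
    refine ⟨⟨a, by simp⟩, ⟨b, by simp⟩, ⟨a, b, by simp [Finset.insert_subset_iff]⟩, ?_⟩
    intro i j hij
    simp only [Finset.insert_subset_iff, Finset.singleton_subset_iff, inl_mem_gridCell,
      inr_mem_gridCell] at hij
    obtain rfl : j = b := by omega
    obtain rfl | rfl : i = a ∨ i = a - 1 := by omega
    exacts [h1, h2]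

theorem inInterior_edge {R : ℤ → ℤ → Prop} {a b : ℤ} :
    InInterior R {inl a, inr b} ↔ R a b ∧ R (a - 1) b ∧ R a (b - 1) ∧ R (a - 1) (b - 1) := by
  constructor
  · intro h
    refine ⟨?_, ?_, ?_, ?_⟩ <;> refine h.cells _ _ ?_ <;> simp [Finset.insert_subset_iff]
  · rintro ⟨h1, h2, h3, h4⟩
    refine ⟨⟨a, by simp⟩, ⟨b, by simp⟩, ⟨a, b, by simp [Finset.insert_subset_iff]⟩, ?_⟩
    intro i j hij
    simp only [Finset.insert_subset_iff, Finset.singleton_subset_iff, inl_mem_gridCell,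
      inr_mem_gridCell] at hij
    obtain rfl | rfl : i = a ∨ i = a - 1 := by omega
    · obtain rfl | rfl : j = b ∨ j = b - 1 := by omega
      exacts [h1, h3]
    · obtain rfl | rfl : j = b ∨ j = b - 1 := by omega
      exacts [h2, h4]

theorem eq_horizontal_or_vertical {T : Finset (ℤ ⊕ ℤ)} (hT : T.card = 3) {i j : ℤ}
    (hsub : T ⊆ gridCell i j) :
    (∃ a b, T = {inl a, inl (a + 1), inr b}) ∨ ∃ a b, T = {inl a, inr b, inr (b + 1)} := by
  obtain ⟨v, hv, hvT⟩ : ∃ v ∈ gridCell i j, v ∉ T := by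
    by_contra! hcon
    have := Finset.card_le_card hcon
    rw [card_gridCell] at this
    omega
  have hTe : T = (gridCell i j).erase v :=
    Finset.eq_of_subset_of_card_le (Finset.subset_erase.2 ⟨hsub, hvT⟩)
      (by rw [Finset.card_erase_of_mem hv, card_gridCell, hT])
  rw [hTe]
  rcases v with x | y
  · right
    rcases inl_mem_gridCell.1 hv with rfl | rfl
    · refine ⟨x + 1, j, ?_⟩
      ext (u | u) <;> simp; omega
    · refine ⟨i, j, ?_⟩
      ext (u | u) <;> simp; omega
  · left
    rcases inr_mem_gridCell.1 hv with rfl | rfl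
    · refine ⟨i, y + 1, ?_⟩
      ext (u | u) <;> simp; omega
    · refine ⟨i, j, ?_⟩
      ext (u | u) <;> simp; omega

/-- Only the two edges joining the paths can be interior, and such an edge is interior when the four
cells around it are in R. Two of these cells contain the triangle; the other two lie in the adjacent
column. -/
theorem horizontal_mem_minimalInteriorTriangles {R : ℤ → ℤ → Prop} {a b : ℤ} :
    {inl a, inl (a + 1), inr b} ∈ minimalInteriorTriangles R ↔
      R a b ∧ R a (b - 1) ∧ ¬ (R (a - 1) b ∧ R (a - 1) (b - 1)) ∧
        ¬ (R (a + 1) b ∧ R (a + 1) (b - 1)) := by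
  have hcard : ({inl a, inl (a + 1), inr b} : Finset (ℤ ⊕ ℤ)).card = 3 := by
    simp [Finset.card_insert_of_notMem]
  have h2 : ∀ u, ({inl u, inr b} : Finset (ℤ ⊕ ℤ)).card = 2 := fun u => by simp
  have hss : ∀ u, u = a ∨ u = a + 1 →
      ({inl u, inr b} : Finset (ℤ ⊕ ℤ)) ⊂ {inl a, inl (a + 1), inr b} := fun u hu => by
    refine Finset.ssubset_iff_subset_ne.2 ⟨?_, fun h => ?_⟩
    · simpa [Finset.insert_subset_iff] using hu
    · have := h2 u
      rw [h] at this
      omega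
  constructor
  · rintro ⟨-, hi, hG⟩
    obtain ⟨h3, h4⟩ := inInterior_horizontal.1 hi
    have h5 := hG _ (hss a (Or.inl rfl))
    have h6 := hG _ (hss (a + 1) (Or.inr rfl))
    rw [inInterior_edge] at h5 h6
    rw [add_sub_cancel_right] at h6
    tauto
  · rintro ⟨h3, h4, h5, h6⟩
    refine ⟨hcard, inInterior_horizontal.2 ⟨h3, h4⟩, fun G hG hi => ?_⟩
    obtain ⟨u, hu⟩ := hi.left
    obtain ⟨v, hv⟩ := hi.right
    obtain rfl : v = b := by simpa using hG.1 hv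
    have hor : u = a ∨ u = a + 1 := by simpa using hG.1 hu
    have hGeq : G = {inl u, inr v} := by
      refine (Finset.eq_of_subset_of_card_le ?_ ?_).symm
      · simp [Finset.insert_subset_iff, hu, hv]
      · rw [h2]
        have := Finset.card_lt_card hG
        omega
    rw [hGeq, inInterior_edge] at hi
    rcases hor with rfl | rfl
    · tauto
    · rw [add_sub_cancel_right] at hi
      tauto

theorem vertical_notMem_minimalInteriorTriangles {R : ℤ → ℤ → Prop} {a b : ℤ}
    (h : R a b → R (a - 1) b → (R a (b - 1) ∧ R (a - 1) (b - 1)) ∨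
      (R a (b + 1) ∧ R (a - 1) (b + 1))) :
    {inl a, inr b, inr (b + 1)} ∉ minimalInteriorTriangles R := by
  rintro ⟨hcard, hi, hG⟩
  obtain ⟨h3, h4⟩ := inInterior_vertical.1 hi
  have hss : ∀ u, u = b ∨ u = b + 1 →
      ({inl a, inr u} : Finset (ℤ ⊕ ℤ)) ⊂ {inl a, inr b, inr (b + 1)} := fun u hu => by
    refine Finset.ssubset_iff_subset_ne.2 ⟨?_, fun h => ?_⟩
    · simpa [Finset.insert_subset_iff] using hu
    · have : ({inl a, inr u} : Finset (ℤ ⊕ ℤ)).card = 2 := by simp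
      rw [h] at this
      omega
  have h5 := hG _ (hss b (Or.inl rfl))
  have h6 := hG _ (hss (b + 1) (Or.inr rfl))
  rw [inInterior_edge] at h5 h6
  rw [add_sub_cancel_right] at h6
  tauto

/-- With two full columns each interior horizontal triangle has full support in an adjacent column,
and heights of at least two do the same for vertical triangles. For s = y₀ + 1 the triangle between
the columns 0 and 1 would be an exception. -/
theorem minimalInteriorTriangles_eq_empty {x₀ y₀ t s : ℤ} (hx : x₀ < 0) (ht : y₀ + 2 ≤ t)
    (hs : s = y₀ ∨ y₀ + 2 ≤ s) (hst : s ≤ t) :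
    minimalInteriorTriangles (staircase x₀ y₀ t 1 s) = ∅ := by
  rw [Set.eq_empty_iff_forall_notMem]
  intro T hT
  obtain ⟨i, j, -, hij⟩ := hT.2.1.inRegion
  rcases eq_horizontal_or_vertical hT.1 hij with ⟨a, b, rfl⟩ | ⟨a, b, rfl⟩
  · rw [horizontal_mem_minimalInteriorTriangles] at hT
    obtain ⟨h1, h2, h3, h4⟩ := hT
    simp only [staircase] at *
    omega
  · revert hT
    apply vertical_notMem_minimalInteriorTriangles
    simp only [staircase]
    omega

/-- The horizontal triangle of column 0 at height j has an interior edge precisely when column 1 has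
cells both above and below that height, that is, when y₀ < j < s. If column 1 is empty, counting
starts at y₀ + 1, the lowest interior height; this is the role of c. -/
theorem ncard_minimalInteriorTriangles {y₀ t s c : ℤ}
    (hs : (s = y₀ ∧ c = y₀ + 1) ∨ (y₀ + 2 ≤ s ∧ c = s)) (hst : s ≤ t) :
    (minimalInteriorTriangles (staircase 0 y₀ t 1 s)).ncard = (t - c).toNat := by
  have : minimalInteriorTriangles (staircase 0 y₀ t 1 s) =
      (fun j => ({inl 0, inl 1, inr j} : Finset (ℤ ⊕ ℤ))) '' (Finset.Ico c t : Set ℤ) := by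
    ext T
    constructor
    · intro hT
      obtain ⟨i, j, -, hij⟩ := hT.2.1.inRegion
      rcases eq_horizontal_or_vertical hT.1 hij with ⟨a, b, rfl⟩ | ⟨a, b, rfl⟩
      · rw [horizontal_mem_minimalInteriorTriangles] at hT
        obtain ⟨h1, h2, h3, h4⟩ := hT
        simp only [staircase] at *
        obtain rfl : a = 0 := by omega
        exact ⟨b, by rw [Finset.mem_coe, Finset.mem_Ico]; omega, rfl⟩
      · revert hT
        refine fun hT => absurd hT (vertical_notMem_minimalInteriorTriangles ?_)
        simp only [staircase]
        omega
    · rintro ⟨b, hb, rfl⟩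
      rw [Finset.mem_coe, Finset.mem_Ico] at hb
      refine horizontal_mem_minimalInteriorTriangles.2 ?_
      simp only [staircase]
      omega
  rw [this, Set.ncard_image_of_injective, Set.ncard_coe_finset, Int.card_Ico]
  intro j j' h
  have : inr j ∈ ({inl 0, inl 1, inr j'} : Finset (ℤ ⊕ ℤ)) := by
    rw [← show ({inl 0, inl 1, inr j} : Finset (ℤ ⊕ ℤ)) = {inl 0, inl 1, inr j'} from h]
    simp
  simpa using this

end Counting

/-! ### Spheres with a positive number of missing tetrahedra. -/

section Existence

open Sum

theorem hasConeSphere_six : HasConeSphere (staircase 0 0 2 1 0) 6 0 := by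
  intro w hw
  have hR : ∀ i j, staircase 0 0 2 1 0 i j ↔ i = 0 ∧ (j = 0 ∨ j = 1) := by
    intro i j; simp only [staircase]; omega
  let Y : Finset (ℤ ⊕ ℤ) := {inl 0, inl 1, inr 0, inr 1, inr 2}
  have hY : Y.card = 5 := rfl
  have hYR : ∀ v ∈ Y, InRegion (staircase 0 0 2 1 0) {v} := by
    intro v hv
    simp only [Y, Finset.mem_insert, Finset.mem_singleton] at hv
    rcases hv with rfl | rfl | rfl | rfl | rfl
    · exact ⟨0, 0, by simp [hR], by simp⟩
    · exact ⟨0, 0, by simp [hR], by simp⟩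
    · exact ⟨0, 0, by simp [hR], by simp⟩
    · exact ⟨0, 0, by simp [hR], by simp⟩
    · exact ⟨0, 1, by simp [hR], by simp⟩
  have hwY : w ∉ Y := fun h => hw (hYR w h)
  have hcellY : ∀ i j, staircase 0 0 2 1 0 i j → gridCell i j ⊆ Y := by
    intro i j hij
    obtain ⟨rfl, rfl | rfl⟩ := (hR i j).1 hij <;> decide
  have hX : (insert w Y).card = 6 := by rw [Finset.card_insert_of_notMem hwY, hY]
  have hlow : IsLowerSet {F | F ⊆ insert w Y ∧ F ≠ insert w Y} := by
    rintro F G hGF ⟨h1, h2⟩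
    have hGF : G ⊆ F := hGF
    exact ⟨hGF.trans h1, fun h => h2 (Finset.Subset.antisymm h1 (h ▸ hGF))⟩
  have hmiss : missingTetra {F | F ⊆ insert w Y ∧ F ≠ insert w Y} = ∅ := by
    rw [Set.eq_empty_iff_forall_notMem]
    rintro F ⟨h1, h2, h3⟩
    refine h2 ⟨fun v hv => ?_, fun h => ?_⟩
    · have : ({v} : Finset (ℤ ⊕ ℤ)) ⊂ F := by
        refine Finset.ssubset_iff_subset_ne.2 ⟨by simpa using hv, fun h => ?_⟩
        rw [← h] at h1
        simp at h1
      exact (h3 _ this).1 (by simp)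
    · rw [h, hX] at h1
      omega
  refine ⟨{F | F ⊆ insert w Y ∧ F ≠ insert w Y}, insert w Y,
    ⟨hlow, fun i j hij h => hwY (hcellY i j hij h), fun i j hij => ?_, ?_⟩, fun F hF => hF.1, hX,
    by simp, ?_, fun F hF hF2 => ⟨hF, ?_⟩, isPLSphereFamily_boundary hX, by simp [hmiss],
    by simp [hmiss]⟩
  · refine ⟨Finset.insert_subset_insert _ (hcellY i j hij), fun h => ?_⟩
    rw [← h, Finset.card_insert_of_notMem fun h => hwY (hcellY i j hij h), card_gridCell] at hX
    omega
  · rintro F G hF hFG hwG ⟨hG1, hG2⟩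
    obtain ⟨a, b, hab, hsub⟩ := hF.inRegion
    obtain ⟨rfl, hb⟩ := (hR a b).1 hab
    -- An interior face must contain the three vertices common to the two cells: otherwise a shifted
    -- cell outside the region would contain it. A facet over it therefore omits `inr 0` or `inr 2`.
    have hshift : ∀ v, v ∉ F → ∀ i j, ¬ staircase 0 0 2 1 0 i j →
        (gridCell 0 b).erase v ⊆ gridCell i j → False := fun v hv i j hn h =>
      hn (hF.cells i j ((Finset.subset_erase.2 ⟨hsub, hv⟩).trans h))
    have h0 : inl 0 ∈ F := by
      by_contra hcon
      refine hshift _ hcon 1 b (by rw [hR]; omega) ?_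
      rcases hb with rfl | rfl <;> decide
    have h1 : inl 1 ∈ F := by
      by_contra hcon
      refine hshift _ hcon (-1) b (by rw [hR]; omega) ?_
      rcases hb with rfl | rfl <;> decide
    have h2 : inr 1 ∈ F := by
      by_contra hcon
      rcases hb with rfl | rfl
      · exact hshift _ hcon 0 (-1) (by rw [hR]; omega) (by decide)
      · exact hshift _ hcon 0 2 (by rw [hR]; omega) (by decide)
    have hGY : G.erase w ⊆ Y := Finset.subset_insert_iff.1 hG1
    obtain ⟨v, hv, hvG⟩ : ∃ v ∈ insert w Y, v ∉ G := by
      by_contra! hcon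
      exact hG2 (Finset.Subset.antisymm hG1 hcon)
    have hGv : G.erase w ⊆ Y.erase v :=
      Finset.subset_erase.2 ⟨hGY, fun h => hvG (Finset.mem_of_mem_erase h)⟩
    simp only [Y, Finset.mem_insert, Finset.mem_singleton] at hv
    rcases hv with rfl | rfl | rfl | rfl | rfl | rfl
    · exact absurd hwG hvG
    · exact absurd (hFG h0) hvG
    · exact absurd (hFG h1) hvG
    · exact ⟨0, 1, by simp [hR], hGv.trans (by decide)⟩
    · exact absurd (hFG h2) hvG
    · exact ⟨0, 0, by simp [hR], hGv.trans (by decide)⟩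
  · intro v hv hvw
    exact hYR v ((Finset.mem_insert.1 hv).resolve_left hvw)
  · rintro rfl
    omega

theorem HasConeSphere.extend_staircase {x₀ y₀ t s : ℤ} {n m k : ℕ} {w : ℤ ⊕ ℤ}
    {R' : ℤ → ℤ → Prop} (h : HasConeSphere (staircase x₀ y₀ t 1 s) n m) (hx : x₀ ≤ 1)
    (hs : y₀ ≤ s) (hst : s ≤ t)
    (hk : (minimalInteriorTriangles (staircase x₀ y₀ t 1 s)).ncard = k)
    (hext : IsExtension (staircase x₀ y₀ t 1 s) w R') : HasConeSphere R' (n + 1) (m + k) :=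
  hk ▸ h.extend (isShellable_staircase hx hs hst) (hasNoMissingTriangle_staircase hst) hext

/-- Wide regions allow to add vertices without creating missing tetrahedra. -/
theorem HasConeSphere.exists_of_le {x₀ y₀ t s : ℤ} {n n' m : ℕ}
    (h : HasConeSphere (staircase x₀ y₀ t 1 s) n m) (hx : x₀ < 0) (ht : y₀ + 2 ≤ t)
    (hs : s = y₀ ∨ y₀ + 2 ≤ s) (hst : s ≤ t) (hn : n ≤ n') :
    ∃ R x, HasConeSphere R n' m ∧ ¬ InRegion R {inl x} := by
  suffices ∃ x₀ < 0, HasConeSphere (staircase x₀ y₀ t 1 s) n' m by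
    obtain ⟨x, hx, h⟩ := this
    refine ⟨_, x - 1, h, not_inRegion_inl.2 ?_⟩
    simp only [staircase]
    omega
  induction n', hn using Nat.le_induction with
  | base => exact ⟨x₀, hx, h⟩
  | succ n' _ ih =>
    obtain ⟨x, hx, h⟩ := ih
    exact ⟨x - 1, by omega, h.extend_staircase (k := 0) (by omega) (by omega) hst
      (by rw [minimalInteriorTriangles_eq_empty hx ht hs hst, Set.ncard_empty])
      (isExtension_staircase_left (by omega) (by omega))⟩

theorem choose_two_succ (k : ℕ) : (k + 1).choose 2 = k.choose 2 + k := by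
  rw [Nat.choose_succ_succ' k 1, Nat.choose_one_right, add_comm]

/-- The single column of height k + 2 contributes k + 1, so the counts add up to 1 + 2 + ... + k,
the largest value binom(n-5, 2) for n = k + 6. -/
theorem hasConeSphere_stacked (k : ℕ) :
    HasConeSphere (staircase 0 0 (k + 2) 1 0) (k + 6) ((k + 1).choose 2) := by
  induction k with
  | zero => exact hasConeSphere_six
  | succ k ih =>
    have h := ih.extend_staircase (k := k + 1) (by omega) le_rfl (by omega)
      (by rw [ncard_minimalInteriorTriangles (Or.inl ⟨rfl, rfl⟩) (by omega)]; omega)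
      (isExtension_staircase_top le_rfl (by omega) (by omega))
    rw [choose_two_succ (k + 1)]
    convert h using 2
    push_cast
    ring

/-- The stacked sphere with `k + 7` vertices, seen over a region with two columns. -/
theorem hasConeSphere_stacked_right (k : ℕ) {s : ℤ} (hs : 2 ≤ s) (hsk : s ≤ k + 2) :
    HasConeSphere (staircase 0 0 (k + 2) 1 s) (k + 7) ((k + 2).choose 2) := by
  have h := (hasConeSphere_stacked k).extend_staircase (k := k + 1) (by omega) le_rfl (by omega)
      (by rw [ncard_minimalInteriorTriangles (Or.inl ⟨rfl, rfl⟩) (by omega)]; omega)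
      (isExtension_staircase_right (s := s) le_rfl (by omega) hsk)
  rwa [← choose_two_succ (k + 1)] at h

theorem exists_hasConeSphere_of_pos {n m : ℕ} (hn : 9 ≤ n) (hm0 : 0 < m)
    (hm : m ≤ (n - 5).choose 2) (hm' : m ≠ (n - 5).choose 2 - 1) :
    ∃ R x, HasConeSphere R n m ∧ ¬ InRegion R {inl x} := by
  rcases hm.eq_or_lt with rfl | hlt
  · obtain ⟨k, rfl⟩ := Nat.exists_eq_add_of_le' (by omega : 6 ≤ n)
    refine ⟨_, 5, hasConeSphere_stacked k, not_inRegion_inl.2 ?_⟩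
    simp only [staircase]
    omega
  · -- `k + 7` is the number of vertices of the largest stacked sphere that is used
    obtain ⟨k, hk1, hk2⟩ : ∃ k : ℕ, (k + 2).choose 2 ≤ m ∧ m < (k + 3).choose 2 := by
      have hex : ∃ k : ℕ, m < (k + 3).choose 2 := by
        refine ⟨n, hlt.trans_le (Nat.choose_le_choose 2 (by omega))⟩
      classical
      refine ⟨Nat.find hex, ?_, Nat.find_spec hex⟩
      rcases Nat.eq_zero_or_eq_succ_pred (Nat.find hex) with h0 | h0
      · rw [h0]; exact hm0
      · have := Nat.find_min hex (m := (Nat.find hex).pred) (by omega)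
        rw [h0]
        simpa [Nat.succ_eq_add_one, add_assoc] using this
    have hkn : k + 8 ≤ n := by
      by_contra hcon
      have := Nat.choose_le_choose 2 (by omega : n - 5 ≤ k + 2)
      omega
    obtain ⟨d, rfl⟩ := Nat.exists_eq_add_of_le hk1
    rw [choose_two_succ (k + 2)] at hk2
    rcases Nat.lt_or_ge d (k + 1) with hd | hd
    -- The second column falls short of the first by d, and s ≥ 2 since d ≤ k. Extending to the left
    -- then gives two full columns.
    · have h := (hasConeSphere_stacked_right k (s := k + 2 - d) (by omega) (by omega)
        ).extend_staircase (k := d) (by omega) (by omega) (by omega)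
        (by rw [ncard_minimalInteriorTriangles (Or.inr ⟨by omega, rfl⟩) (by omega)]; omega)
        (isExtension_staircase_left le_rfl (by omega))
      exact h.exists_of_le (by omega) (by omega) (Or.inr (by omega)) (by omega) hkn
    · obtain rfl : d = k + 1 := by omega
      -- For n = k + 8 the value of m would be binom(n-5, 2) - 1, which is excluded.
      have hkn : k + 9 ≤ n := by
        rcases hkn.eq_or_lt with rfl | hlt
        · refine absurd ?_ hm'
          rw [show k + 8 - 5 = k + 2 + 1 by omega, choose_two_succ (k + 2)]
          omega
        · exact hlt
      -- The remainder k + 1 is produced by two consecutive steps with nearly equal contributions.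
      obtain ⟨j, hj⟩ : ∃ j : ℕ, k + 1 = j + j ∨ k + 1 = j + (j + 1) := ⟨(k + 1) / 2, by omega⟩
      have hstart := hasConeSphere_stacked_right k (s := k + 2 - j) (by omega) (by omega)
      have hcount : (minimalInteriorTriangles (staircase 0 0 (k + 2) 1 (k + 2 - j))).ncard = j := by
        rw [ncard_minimalInteriorTriangles (Or.inr ⟨by omega, rfl⟩) (by omega)]; omega
      rcases hj with hj | hj
      -- A new bottom row lengthens both columns, so their difference is j again.
      · have h := ((hstart.extend_staircase (by omega) (by omega) (by omega) hcount
          (isExtension_staircase_bottom le_rfl (by omega) (by omega))).extend_staircase (k := j)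
          (by omega) (by omega) (by omega)
          (by rw [ncard_minimalInteriorTriangles (Or.inr ⟨by omega, rfl⟩) (by omega)]; omega)
          (isExtension_staircase_left le_rfl (by omega))).exists_of_le (n' := n) (by omega)
          (by omega) (Or.inr (by omega)) (by omega) hkn
        rwa [add_assoc, ← hj] at h
      -- A new top row lengthens only column 0, so the difference grows to j + 1.
      · have h := ((hstart.extend_staircase (by omega) (by omega) (by omega) hcount
          (isExtension_staircase_top le_rfl (by omega) (by omega))).extend_staircase (k := j + 1)
          (by omega) (by omega) (by omega)
          (by rw [ncard_minimalInteriorTriangles (Or.inr ⟨by omega, rfl⟩) (by omega)]; omega)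
          (isExtension_staircase_left le_rfl (by omega))).exists_of_le (n' := n) (by omega)
          (by omega) (Or.inr (by omega)) (by omega) hkn
        rwa [add_assoc, ← hj] at h

theorem HasConeSphere.exists_complex {R : ℤ → ℤ → Prop} {n m : ℕ} {w : ℤ ⊕ ℤ}
    (h : HasConeSphere R n m) (hw : ¬ InRegion R {w}) (hn : 2 ≤ n) :
    ∃ Δ : AbstractSimplicialComplex (Fin n),
      Δ.IsPLSphere 4 ∧ Δ.IsNeighborly 2 ∧ Δ.missingFaceCount 3 = m := by
  obtain ⟨K, X, hK⟩ := h w hw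
  exact exists_complex_of_family hK.card hK.cone.lower hK.subset hn hK.edge hK.sphere hK.missing

end Existence

/-! ### Flips on lists of facets, in decidable form. -/

section FacetLists

variable {V : Type} [DecidableEq V]

/-- The family of all subsets of the members of `L`. -/
def facetFamily (L : List (Finset V)) : Set (Finset V) := {F | ∃ G ∈ L, F ⊆ G}

/-- The effect of a bistellar flip on the list of facets. -/
def flipFacets (L : List (Finset V)) (σ τ : List V) : List (Finset V) :=
  σ.map (fun v => (σ.toFinset ∪ τ.toFinset).erase v) ++ L.filter fun G => ¬ σ.toFinset ⊆ G

/-- The conditions for a bistellar flip in terms of facets. -/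
def CanFlip (L : List (Finset V)) (σ τ : List V) : Prop :=
  2 ≤ σ.toFinset.card ∧ τ ≠ [] ∧ Disjoint σ.toFinset τ.toFinset ∧
    (∀ G ∈ L, σ.toFinset ⊆ G → G ⊆ σ.toFinset ∪ τ.toFinset) ∧
    (∀ v ∈ τ, ∃ G ∈ L, (σ.toFinset ∪ τ.toFinset).erase v ⊆ G) ∧ ∀ G ∈ L, ¬ τ.toFinset ⊆ G

instance (L : List (Finset V)) (σ τ : List V) : Decidable (CanFlip L σ τ) := by
  unfold CanFlip; infer_instance

/-- All flips of a list can be performed successively. -/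
def CanFlipAll : List (Finset V) → List (List V × List V) → Prop
  | _, [] => True
  | L, p :: ps => CanFlip L p.1 p.2 ∧ CanFlipAll (flipFacets L p.1 p.2) ps

instance decidableCanFlipAll : (L : List (Finset V)) → (ps : List (List V × List V)) →
    Decidable (CanFlipAll L ps)
  | _, [] => .isTrue trivial
  | L, p :: ps =>
    have := decidableCanFlipAll (flipFacets L p.1 p.2) ps
    inferInstanceAs (Decidable (_ ∧ _))

omit [DecidableEq V] in
theorem isLowerSet_facetFamily (L : List (Finset V)) : IsLowerSet (facetFamily L) := by
  rintro F G hGF ⟨H, hH, hFH⟩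
  exact ⟨H, hH, subset_trans hGF hFH⟩

theorem CanFlip.isFlippable {L : List (Finset V)} {σ τ : List V} (h : CanFlip L σ τ) :
    IsFlippable (facetFamily L) σ.toFinset τ.toFinset := by
  obtain ⟨h1, h2, h3, h4, h5, h6⟩ := h
  refine ⟨isLowerSet_facetFamily L, h3, Finset.card_pos.1 (by omega), ?_, ?_, ?_, ?_⟩
  · rwa [List.toFinset_nonempty_iff]
  · rintro F ⟨G, hG, hFG⟩ hs
    exact hFG.trans (h4 G hG (hs.trans hFG))
  · intro F hF hs
    obtain ⟨v, hv, hvF⟩ := Finset.not_subset.1 hs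
    obtain ⟨G, hG, hsub⟩ := h5 v (List.mem_toFinset.1 hv)
    exact ⟨G, hG, (Finset.subset_erase.2 ⟨hF, hvF⟩).trans hsub⟩
  · rintro ⟨G, hG, hs⟩
    exact h6 G hG hs

theorem CanFlip.facetFamily_flipFacets {L : List (Finset V)} {σ τ : List V} (h : CanFlip L σ τ) :
    facetFamily (flipFacets L σ τ) = bistellarFlip (facetFamily L) σ.toFinset τ.toFinset := by
  have hf := h.isFlippable
  ext F
  have hmem : F ∈ facetFamily (flipFacets L σ τ) ↔
      (∃ v ∈ σ.toFinset, F ⊆ (σ.toFinset ∪ τ.toFinset).erase v) ∨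
        ∃ G ∈ L, ¬ σ.toFinset ⊆ G ∧ F ⊆ G := by
    simp only [facetFamily, flipFacets, Set.mem_ofPred_eq, List.mem_append, List.mem_map,
      List.mem_filter, decide_eq_true_eq, List.mem_toFinset]
    constructor
    · rintro ⟨G, ⟨v, hv, rfl⟩ | ⟨hG, hs⟩, hF⟩
      exacts [Or.inl ⟨v, hv, hF⟩, Or.inr ⟨G, hG, hs, hF⟩]
    · rintro (⟨v, hv, hF⟩ | ⟨G, hG, hs, hF⟩)
      exacts [⟨_, Or.inl ⟨v, hv, rfl⟩, hF⟩, ⟨G, Or.inr ⟨hG, hs⟩, hF⟩]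
  rw [hmem]
  have hnew : F ⊆ σ.toFinset ∪ τ.toFinset → ¬ σ.toFinset ⊆ F →
      ∃ v ∈ σ.toFinset, F ⊆ (σ.toFinset ∪ τ.toFinset).erase v := fun hF hs => by
    obtain ⟨v, hv, hvF⟩ := Finset.not_subset.1 hs
    exact ⟨v, hv, Finset.subset_erase.2 ⟨hF, hvF⟩⟩
  constructor
  · rintro (⟨v, hv, hF⟩ | ⟨G, hG, hs, hF⟩)
    · obtain ⟨hF1, hF2⟩ := Finset.subset_erase.1 hF
      by_cases ht : τ.toFinset ⊆ F
      · exact Or.inr ⟨ht, hF1, fun hs => hF2 (hs hv)⟩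
      · exact Or.inl ⟨hf.mem F hF1 ht, fun hs => hF2 (hs hv)⟩
    · exact Or.inl ⟨⟨G, hG, hF⟩, fun h => hs (h.trans hF)⟩
  · rintro (⟨⟨G, hG, hF⟩, hs⟩ | ⟨-, h2, h3⟩)
    · by_cases hsG : σ.toFinset ⊆ G
      · exact Or.inl (hnew (hF.trans (hf.star G ⟨G, hG, subset_rfl⟩ hsG)) hs)
      · exact Or.inr ⟨G, hG, hsG, hF⟩
    · exact Or.inl (hnew h2 h3)

theorem IsPLSphereFamily.foldl_flipFacets {d : ℕ} (ps : List (List V × List V)) :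
    ∀ {L : List (Finset V)}, IsPLSphereFamily (facetFamily L) d → CanFlipAll L ps →
      IsPLSphereFamily (facetFamily (ps.foldl (fun L p => flipFacets L p.1 p.2) L)) d := by
  induction ps with
  | nil => exact fun h _ => h
  | cons p ps ih =>
    rintro L h ⟨h1, h2⟩
    refine ih ?_ h2
    rw [h1.facetFamily_flipFacets]
    exact h.flip h1.isFlippable h1.1

end FacetLists

/-! ### A nine-vertex sphere without missing tetrahedra, and its extensions. -/

section NoMissingTetrahedra

open Sum

/-- The facets of the boundary of a `5`-simplex. -/
def startFacets : List (Finset (ℤ ⊕ ℤ)) :=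
  [inr 0, inr 1, inr 2, inl (-1), inl 1, inl 0].map
    ({inr 0, inr 1, inr 2, inl (-1), inl 1, inl 0} : Finset (ℤ ⊕ ℤ)).erase

/-- Bistellar flips that lead to a `2`-neighborly sphere without missing tetrahedra. -/
def nineVertexFlips : List (List (ℤ ⊕ ℤ) × List (ℤ ⊕ ℤ)) :=
  [([inr 0, inr 1, inr 2, inl 1, inl 0], [inr 3]),
   ([inr 0, inr 2, inl 1, inl 0], [inl (-1), inr 3]),
   ([inr 0, inr 2, inl (-1), inr 3, inl 0], [inr 4]),
   ([inr 0, inr 2, inr 3, inl 0], [inr 1, inr 4]),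
   ([inr 0, inr 2, inl 0], [inr 1, inl (-1), inr 4]),
   ([inr 0, inr 1, inr 3, inl 0], [inl 1, inr 4]),
   ([inr 0, inl (-1), inr 3, inl 1, inl 0], [inl (-2)]),
   ([inr 0, inl (-1), inr 3, inl 0], [inl (-2), inr 4]),
   ([inr 0, inr 3, inl 0], [inl (-2), inl 1, inr 4]),
   ([inl (-1), inr 3, inl 1, inl 0], [inl (-2), inr 2]),
   ([inr 2, inl (-1), inl 1, inl 0], [inl (-2), inr 1]),
   ([inl (-1), inl 1, inl 0], [inl (-2), inr 0, inr 1])]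

/-- The facets of a `2`-neighborly sphere with nine vertices and no missing tetrahedra. -/
def nineVertexFacets : List (Finset (ℤ ⊕ ℤ)) :=
  nineVertexFlips.foldl (fun L p => flipFacets L p.1 p.2) startFacets

/-- The nine vertices. -/
def nineVertices : Finset (ℤ ⊕ ℤ) :=
  {inl (-2), inl (-1), inl 0, inl 1, inr 0, inr 1, inr 2, inr 3, inr 4}

/-- The missing triangles of the sphere with facets `nineVertexFacets`. -/
def nineVertexMissingTriangles : List (Finset (ℤ ⊕ ℤ)) :=
  [{inl (-2), inr 0, inr 2},
   {inl (-2), inr 1, inr 3},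
   {inl (-2), inr 1, inr 4},
   {inl (-2), inr 2, inr 4},
   {inr 0, inr 2, inl 0},
   {inr 0, inr 3, inl 0},
   {inr 1, inl (-1), inr 3},
   {inr 2, inl 1, inr 4},
   {inl (-1), inl 1, inr 4},
   {inl (-1), inl 1, inl 0}]

theorem facetFamily_startFacets : facetFamily startFacets =
    {F | F ⊆ {inr 0, inr 1, inr 2, inl (-1), inl 1, inl 0} ∧ F ≠ {inr 0, inr 1, inr 2, inl (-1), inl 1, inl 0}} := by
  ext F
  have hlist : ∀ v, v ∈ [inr 0, inr 1, inr 2, inl (-1), inl 1, inl 0] ↔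
      v ∈ ({inr 0, inr 1, inr 2, inl (-1), inl 1, inl 0} : Finset (ℤ ⊕ ℤ)) := by
    intro v; simp
  have hset : ({inr 0, inr 1, inr 2, inl (-1), inl 1, inl 0} : Finset (ℤ ⊕ ℤ)) = {inr 0, inr 1, inr 2, inl (-1), inl 1, inl 0} := rfl
  rw [facetFamily, startFacets, hset, Set.mem_ofPred_eq, Set.mem_ofPred_eq]
  generalize ({inr 0, inr 1, inr 2, inl (-1), inl 1, inl 0} : Finset (ℤ ⊕ ℤ)) = S at *
  simp only [List.mem_map, hlist, exists_exists_and_eq_and, Finset.subset_erase]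
  constructor
  · rintro ⟨v, hv, h1, h2⟩
    exact ⟨h1, fun h => h2 (h ▸ hv)⟩
  · rintro ⟨h1, h2⟩
    obtain ⟨v, hv, hvF⟩ := Finset.not_subset.1 fun h => h2 (Finset.Subset.antisymm h1 h)
    exact ⟨v, hv, h1, hvF⟩

theorem canFlipAll_nineVertexFlips : CanFlipAll startFacets nineVertexFlips := by
  decide +kernel

theorem nineVertexFacets_subset : ∀ G ∈ nineVertexFacets, G ⊆ nineVertices := by
  decide +kernel

theorem nineVertexFacets_edges :
    ∀ a ∈ nineVertices, ∀ b ∈ nineVertices, ∃ G ∈ nineVertexFacets, a ∈ G ∧ b ∈ G := by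
  decide +kernel

/-- A non-face of size four that contains a non-face of size three is not minimal, so the listed
triangles certify that there are no missing tetrahedra. -/
theorem nineVertexFacets_missing : ∀ F ∈ nineVertices.powersetCard 4,
    (∃ G ∈ nineVertexFacets, F ⊆ G) ∨ ∃ T ∈ nineVertexMissingTriangles, T ⊆ F := by
  decide +kernel

theorem nineVertexMissingTriangles_notMem : ∀ T ∈ nineVertexMissingTriangles,
    T.card = 3 ∧ ∀ G ∈ nineVertexFacets, ¬ T ⊆ G := by
  decide +kernel

theorem nineVertexFacets_cells : ∀ i ∈ [-1, 0], ∀ j ∈ [0, 1, 2, 3],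
    ∃ G ∈ nineVertexFacets, insert (inl (-2)) (gridCell i j) ⊆ G := by
  decide +kernel

/-- An interior face of the region with columns -1, 0 and rows 0, ..., 3 contains `inl 0` and one of
`inr 1`, `inr 2`, `inr 3`, so the star condition needs checking only on such facets. -/
theorem nineVertexFacets_star : ∀ G ∈ nineVertexFacets, inl (-2) ∈ G → inl 0 ∈ G →
    (∃ j ∈ [1, 2, 3], inr j ∈ G) →
      ∃ i ∈ [-1, 0], ∃ j ∈ [0, 1, 2, 3], G.erase (inl (-2)) ⊆ gridCell i j := by
  decide +kernel

theorem nineVertices_spanning : ∀ v ∈ nineVertices, v ≠ inl (-2) →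
    ∃ i ∈ [-1, 0], ∃ j ∈ [0, 1, 2, 3], v ∈ gridCell i j := by
  decide +kernel

theorem isConeSphere_nineVertices :
    IsConeSphere (facetFamily nineVertexFacets) nineVertices (inl (-2))
      (staircase (-1) 0 4 1 0) 9 0 := by
  have hR : ∀ i j, staircase (-1) 0 4 1 0 i j ↔ i ∈ [-1, 0] ∧ j ∈ [0, 1, 2, 3] := by
    intro i j
    simp only [staircase, List.mem_cons, List.not_mem_nil, or_false]
    omega
  have hsubX : ∀ F ∈ facetFamily nineVertexFacets, F ⊆ nineVertices := by
    rintro F ⟨G, hG, hFG⟩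
    exact hFG.trans (nineVertexFacets_subset G hG)
  have hmiss : missingTetra (facetFamily nineVertexFacets) = ∅ := by
    rw [Set.eq_empty_iff_forall_notMem]
    rintro F ⟨h1, h2, h3⟩
    have hF : F ⊆ nineVertices := by
      intro v hv
      refine hsubX {v} (h3 {v} ?_) (by simp)
      refine Finset.ssubset_iff_subset_ne.2 ⟨by simpa using hv, fun h => ?_⟩
      rw [← h] at h1
      simp at h1
    rcases nineVertexFacets_missing F (Finset.mem_powersetCard.2 ⟨hF, h1⟩) with h | ⟨T, hT, hTF⟩
    · exact h2 h
    · obtain ⟨hT1, hT2⟩ := nineVertexMissingTriangles_notMem T hT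
      obtain ⟨G, hG, hTG⟩ := h3 T (Finset.ssubset_iff_subset_ne.2 ⟨hTF, fun h => by
        rw [h] at hT1; omega⟩)
      exact hT2 G hG hTG
  refine ⟨⟨isLowerSet_facetFamily _, ?_, fun i j hij => ?_, ?_⟩, hsubX, rfl, by decide, ?_, ?_, ?_,
    by simp [hmiss], by simp [hmiss]⟩
  · intro i j hij
    simp only [staircase] at hij
    simp
    omega
  · obtain ⟨hi, hj⟩ := (hR i j).1 hij
    exact nineVertexFacets_cells i hi j hj
  · rintro F G hF hFG hwG ⟨H, hH, hGH⟩
    obtain ⟨a, b, hab, hsub⟩ := hF.inRegion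
    have h0 : inl 0 ∈ F := by
      by_contra hcon
      have hab' := hab
      simp only [staircase] at hab'
      -- Without the middle vertex `inl 0`, the face also lies in the adjacent column outside the
      -- region.
      have h1 : F ⊆ gridCell (if a = 0 then 1 else -2) b := by
        rintro (u | u) hu
        · have h1 := inl_mem_gridCell.1 (hsub hu)
          have h2 : u ≠ 0 := by rintro rfl; exact hcon hu
          rw [inl_mem_gridCell]
          split_ifs <;> omega
        · simpa using hsub hu
      have h2 := hF.cells _ _ h1
      simp only [staircase] at h2
      split_ifs at h2 <;> omega
    obtain ⟨j, hj, hj'⟩ : ∃ j, inr j ∈ F ∧ j ∈ [1, 2, 3] := by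
      by_contra! hcon
      have hab' := hab
      simp only [staircase] at hab'
      have hends : ∀ u, inr u ∈ F → u = 0 ∨ u = 4 := fun u hu => by
        have h1 := inr_mem_gridCell.1 (hsub hu)
        have h2 := hcon u hu
        simp only [List.mem_cons, List.not_mem_nil, or_false, not_or] at h2
        omega
      have h1 : F ⊆ gridCell a (if b = 0 then -1 else 4) := by
        rintro (u | u) hu
        · simpa using hsub hu
        · have h1 := inr_mem_gridCell.1 (hsub hu)
          have h2 := hends u hu
          rw [inr_mem_gridCell]
          split_ifs <;> omega
      have h2 := hF.cells _ _ h1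
      simp only [staircase] at h2
      split_ifs at h2 <;> omega
    obtain ⟨i', hi', j', hj'', h⟩ := nineVertexFacets_star H hH (hGH hwG) (hGH (hFG h0))
      ⟨j, hj', hGH (hFG hj)⟩
    exact ⟨i', j', (hR i' j').2 ⟨hi', hj''⟩, (Finset.erase_subset_erase _ hGH).trans h⟩
  · intro v hv hvw
    obtain ⟨i, hi, j, hj, h⟩ := nineVertices_spanning v hv hvw
    exact ⟨i, j, (hR i j).2 ⟨hi, hj⟩, by simpa using h⟩
  · intro F hF hF2
    obtain ⟨a, b, -, rfl⟩ := Finset.card_eq_two.1 hF2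
    obtain ⟨G, hG, ha, hb⟩ := nineVertexFacets_edges a (hF (by simp)) b (hF (by simp))
    exact ⟨G, hG, by simp [Finset.insert_subset_iff, ha, hb]⟩
  · refine IsPLSphereFamily.foldl_flipFacets _ ?_ canFlipAll_nineVertexFlips
    rw [facetFamily_startFacets]
    exact isPLSphereFamily_boundary rfl

theorem exists_complex_missing_zero {n : ℕ} (hn : 9 ≤ n) :
    ∃ Δ : AbstractSimplicialComplex (Fin n),
      Δ.IsPLSphere 4 ∧ Δ.IsNeighborly 2 ∧ Δ.missingFaceCount 3 = 0 := by
  have h := isConeSphere_nineVertices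
  rcases hn.eq_or_lt with rfl | hlt
  · exact exists_complex_of_family h.card h.cone.lower h.subset (by omega) h.edge h.sphere h.missing
  -- The nine-vertex sphere has the fixed apex `inl (-2)`, which is just the next abscissa on the
  -- left. After one extension the name of the apex is free.
  · have h10 : HasConeSphere (staircase (-2) 0 4 1 0) 10 0 := fun w' hw' => by
      have h' := h.reconed (isShellable_staircase (by omega) le_rfl (by omega))
        (hasNoMissingTriangle_staircase (by omega))
        (isExtension_staircase_left (by omega) (by omega)) hw'
      rw [minimalInteriorTriangles_eq_empty (by omega) (by omega) (Or.inl rfl) (by omega),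
        Set.ncard_empty] at h'
      exact ⟨_, _, h'⟩
    obtain ⟨R, x, hR, hx⟩ := h10.exists_of_le (by omega) (by omega) (Or.inl rfl) (by omega) hlt
    exact hR.exists_complex hx (by omega)

end NoMissingTetrahedra

/-- An `AbstractSimplicialComplex (Fin n)` contains every singleton of `Fin n`, so it has exactly
`n` vertices. -/
theorem mainTheorem3 (n : ℕ) (hn : 9 ≤ n) (m : ℕ) (hm : m ≤ (n - 5).choose 2)
    (hm' : m ≠ (n - 5).choose 2 - 1) :
    ∃ Δ : AbstractSimplicialComplex (Fin n),
      Δ.IsPLSphere 4 ∧ Δ.IsNeighborly 2 ∧ Δ.missingFaceCount 3 = m := by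
  rcases Nat.eq_zero_or_pos m with rfl | hm0
  · exact exists_complex_missing_zero hn
  · obtain ⟨R, x, hR, hx⟩ := exists_hasConeSphere_of_pos hn hm0 hm hm'
    exact hR.exists_complex hx (by omega)
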